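/- Let $K$ be a field, $S=K[x_1,\dots,x_N]$, and let $M\subseteq S$ be a monomial ideal with minimal generating set $G$. A monomial $m\in G$ is dominant if there are a variable $x$ and an integer $k>0$ such that $x^k\mid m$ and $x^k\nmid m'$ for all $m'\in G\setminus\{m\}$. Assume that $M$ is semidominant, i.e. exactly one element $n$ of $G$ is not dominant, and write $G=\{m_1,\dots,m_q,n\}$. Let $\mathbb T_M$ be the Taylor resolution of $S/M$: after fixing an ordering of $G$, it has as basis the elements $[\sigma]=[l_1,\dots,l_p]$ for the subsets $\sigma=\{l_1,\dots,l_p\}$ of $G$ (listed in order), with $[\sigma]$ in homological degree $p$ and of multidegree $\operatorname{mdeg}[\sigma]=\operatorname{lcm}(l_1,\dots,l_p)$ (where $\operatorname{lcm}(\varnothing)=1$), and differential $$[l_1,\dots,l_p]\mapsto\sum_{i=1}^p(-1)^{i+1}\frac{\operatorname{mdeg}[l_1,\dots,l_p]}{\operatorname{mdeg}[l_1,\dots,\widehat{l_i},\dots,l_p]}\,[l_1,\dots,\widehat{l_i},\dots,l_p].$$ For a multigraded free complex with a homogeneous basis, let $a_{\tau\sigma}$ denote the coefficient of the basis element $[\tau]$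 in $d[\sigma]$. If $a_{\tau\sigma}$ is invertible, where $[\sigma]$ and $[\tau]$ are in homological degrees $j+1$ and $j$, the standard cancellation $0\to S[\sigma]\to S[\tau]\to0$ is the following operation: pass to the new basis given by $[\tau]'=d[\sigma]$, by $[\beta]'=[\beta]-\frac{a_{\tau\beta}}{a_{\tau\sigma}}[\sigma]$ for the basis elements $[\beta]\neq[\sigma]$ in homological degree $j+1$, and by $[\beta]'=[\beta]$ for all other basis elements; then delete $[\sigma]'$ and $[\tau]'$ from the basis, and the corresponding rows and columns from the differential matrices. The remaining $[\beta]'$ are again denoted $[\beta]$. Let $$A=\{([m_{i_1},\dots,m_{i_j},n],[m_{i_1},\dots,m_{i_j}])\;:\;\{m_{i_1},\dots,m_{i_j}\}\subseteq\{m_1,\dots,m_q\},\ n\mid\operatorname{lcm}(m_{i_1},\dots,m_{i_j})\}.$$ Then: 1. Starting with $\mathbb T_M$, one can make, one after the other and in any order, all the standard cancellations $0\to S[\sigma]\to S[\tau]\to0$ with $([\sigma],[\tau])\in A$, and the result is a minimal free resolution of $S/M$. 2. If $\mathbb F$ is the minimal multigraded free resolution of $S/M$ (that is, any multigraded free resolution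 of $S/M$ by finitely generated free modules with multidegrees in $\mathbb N^N$ and $d(\mathbb F)\subseteq(x_1,\dots,x_N)\mathbb F$), then, as multigraded complexes, $$\mathbb T_M\cong\mathbb F\oplus\bigoplus_{([\sigma],[\tau])\in A}\bigl(0\to S[\sigma]\to S[\tau]\to0\bigr),$$ where in each summand $[\sigma]\mapsto[\tau]$, and $[\sigma]$ and $[\tau]$ have the same homological degrees and multidegrees as in $\mathbb T_M$. -/

import Mathlib

open MvPolynomial

/-! ### Monomial ideals, dominance

A monomial in the variables `X` is represented by its exponent vector `a : X →₀ ℕ`; divisibility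
of monomials is `≤`, and the least common multiple is the supremum. -/

/-- `M` is generated by monomials. -/
def IsMonomialIdeal {K X : Type*} [Field K] (M : Ideal (MvPolynomial X K)) : Prop :=
  ∃ E : Set (X →₀ ℕ), M = Ideal.span ((fun a => monomial a (1 : K)) '' E)

/-- The minimal generating set of a monomial ideal `M`: the monomials of `M` that are minimal
with respect to divisibility. -/
def minimalGenerators {K X : Type*} [Field K] (M : Ideal (MvPolynomial X K)) : Set (X →₀ ℕ) :=
  {a | Minimal (fun b => monomial b (1 : K) ∈ M) a}

/-- `x` is a dominant variable of `m` with respect to `G`: for some positive `k`, `x ^ k` divides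
`m` and divides no other element of `G`. -/
def IsDominantVariable {X : Type*} (G : Set (X →₀ ℕ)) (m : X →₀ ℕ) (x : X) : Prop :=
  ∃ k : ℕ, 0 < k ∧ k ≤ m x ∧ ∀ m' ∈ G, m' ≠ m → ¬ k ≤ m' x

/-- `m` is a dominant monomial with respect to `G`. -/
def IsDominantMonomial {X : Type*} (G : Set (X →₀ ℕ)) (m : X →₀ ℕ) : Prop :=
  ∃ x, IsDominantVariable G m x

/-- Exactly one element of `G` is not dominant. -/
def IsSemidominantSet {X : Type*} (G : Set (X →₀ ℕ)) : Prop :=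
  ∃! n, n ∈ G ∧ ¬ IsDominantMonomial G n

/-- A monomial ideal whose minimal generating set is semidominant. -/
def IsSemidominantIdeal {K X : Type*} [Field K] (M : Ideal (MvPolynomial X K)) : Prop :=
  IsMonomialIdeal M ∧ IsSemidominantSet (minimalGenerators M)

/-! ### Multigraded free complexes with a basis -/

/-- The data of a complex of multigraded free modules over `S = K[X]` with a chosen homogeneous
basis `B`: each basis element has a homological degree and a multidegree, and `d` is the
differential on the direct sum `B →₀ S` of all the modules. The axioms are in
`BasedComplex.IsComplex`. -/
structure BasedComplex (K X B : Type*) [Field K] where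
  /-- homological degree of a basis element -/
  hdeg : B → ℕ
  /-- multidegree of a basis element -/
  mdeg : B → X →₀ ℕ
  /-- differential -/
  d : (B →₀ MvPolynomial X K) →ₗ[MvPolynomial X K] (B →₀ MvPolynomial X K)

namespace BasedComplex

variable {K X B B' : Type*} [Field K]

/-- The module in homological degree `j`. -/
noncomputable def chains (C : BasedComplex K X B) (j : ℕ) :
    Submodule (MvPolynomial X K) (B →₀ MvPolynomial X K) :=
  Finsupp.supported (MvPolynomial X K) (MvPolynomial X K) {b | C.hdeg b = j}

/-- `x` lies in homological degree `j` and is homogeneous of multidegree `a`. -/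
def IsHomogeneous (C : BasedComplex K X B) (j : ℕ) (a : X →₀ ℕ) (x : B →₀ MvPolynomial X K) :
    Prop :=
  ∀ b, x b ≠ 0 → C.hdeg b = j ∧ C.mdeg b ≤ a ∧ ∃ c : K, x b = monomial (a - C.mdeg b) c

/-- The entry `a_{τσ}` of the differential matrix: the coefficient of `[τ]` in `d [σ]`. -/
noncomputable def entry (C : BasedComplex K X B) (τ σ : B) : MvPolynomial X K :=
  C.d (Finsupp.single σ 1) τ

/-- `C` is a complex of finitely generated multigraded free modules, with differential of
homological degree `-1` and multidegree `0`. -/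
structure IsComplex (C : BasedComplex K X B) : Prop where
  finite : ∀ j, {b | C.hdeg b = j}.Finite
  d_zero : ∀ b, C.hdeg b = 0 → C.d (Finsupp.single b 1) = 0
  d_homogeneous : ∀ b j, C.hdeg b = j + 1 →
    C.IsHomogeneous j (C.mdeg b) (C.d (Finsupp.single b 1))
  d_comp_d : C.d ∘ₗ C.d = 0

/-- `C` is a multigraded free resolution of `S / M`: there is a multigraded augmentation `ε` such
that `⋯ → C₁ → C₀ → S / M → 0` is exact. Only the restriction of `ε` to `C₀` matters. -/
def IsFreeResolution (C : BasedComplex K X B) (M : Ideal (MvPolynomial X K)) : Prop :=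
  C.IsComplex ∧
  ∃ ε : (B →₀ MvPolynomial X K) →ₗ[MvPolynomial X K] (MvPolynomial X K ⧸ M),
    (∀ b, C.hdeg b = 0 →
      ∃ c : K, ε (Finsupp.single b 1) = Ideal.Quotient.mk M (monomial (C.mdeg b) c)) ∧
    (C.chains 0).map ε = ⊤ ∧
    LinearMap.ker ε ⊓ C.chains 0 = (C.chains 1).map C.d ∧
    ∀ j, LinearMap.ker C.d ⊓ C.chains (j + 1) = (C.chains (j + 2)).map C.d

/-- A free resolution with `d F ⊆ 𝔪 F`, where `𝔪` is generated by the variables. -/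
def IsMinimalFreeResolution (C : BasedComplex K X B) (M : Ideal (MvPolynomial X K)) : Prop :=
  C.IsFreeResolution M ∧
  LinearMap.range C.d ≤
    Ideal.span (Set.range (MvPolynomial.X : X → MvPolynomial X K)) •
      (⊤ : Submodule (MvPolynomial X K) (B →₀ MvPolynomial X K))

/-- Isomorphism of multigraded complexes (of homological degree `0` and multidegree `0`). -/
def Iso (C : BasedComplex K X B) (C' : BasedComplex K X B') : Prop :=
  ∃ φ : (B →₀ MvPolynomial X K) ≃ₗ[MvPolynomial X K] (B' →₀ MvPolynomial X K),
    (∀ b, C'.IsHomogeneous (C.hdeg b) (C.mdeg b) (φ (Finsupp.single b 1))) ∧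
    ∀ x, φ (C.d x) = C'.d (φ x)

/-- The direct sum of two complexes. -/
noncomputable def sum (C : BasedComplex K X B) (C' : BasedComplex K X B') :
    BasedComplex K X (B ⊕ B') where
  hdeg := Sum.elim C.hdeg C'.hdeg
  mdeg := Sum.elim C.mdeg C'.mdeg
  d := Finsupp.linearCombination (MvPolynomial X K) (Sum.elim
    (fun b => (C.d (Finsupp.single b 1)).mapDomain Sum.inl)
    (fun b => (C'.d (Finsupp.single b 1)).mapDomain Sum.inr))

/-- The direct sum of a family of complexes. -/
noncomputable def directSum {I : Type*} {N : I → Type*} (C : ∀ i, BasedComplex K X (N i)) :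
    BasedComplex K X (Σ i, N i) where
  hdeg b := (C b.1).hdeg b.2
  mdeg b := (C b.1).mdeg b.2
  d := Finsupp.linearCombination (MvPolynomial X K)
    (fun b => ((C b.1).d (Finsupp.single b.2 1)).mapDomain (Sigma.mk b.1))

/-- The complex `0 → S[σ] → S[τ] → 0` in which `[σ]` is sent to `[τ]`; the basis element `[σ]` is
indexed by `true` and `[τ]` by `false`, and both keep the degrees they have in `C`. -/
noncomputable def trivialComplex (C : BasedComplex K X B) (σ τ : B) : BasedComplex K X Bool where
  hdeg b := C.hdeg (bif b then σ else τ)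
  mdeg b := C.mdeg (bif b then σ else τ)
  d := Finsupp.linearCombination (MvPolynomial X K)
    (fun b => bif b then Finsupp.single false 1 else 0)

open Classical in
/-- The standard change of basis around the invertible entry `a_{τσ}`: `[τ]' = d [σ]`, and
`[b]' = [b] - (a_{τb} / a_{τσ}) [σ]` for the other basis elements `[b]` in the homological degree
of `[σ]`; the remaining basis elements do not change. -/
noncomputable def standardChange (C : BasedComplex K X B) (σ τ b : B) : B →₀ MvPolynomial X K :=
  if b = τ then C.d (Finsupp.single σ 1)
  else if C.hdeg b = C.hdeg σ ∧ b ≠ σ then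
    Finsupp.single b 1 - (C.entry τ b * Ring.inverse (C.entry τ σ)) • Finsupp.single σ 1
  else Finsupp.single b 1

/-- `C'` is obtained from `C` by the standard cancellation `0 → S[σ] → S[τ] → 0`, where `f`
identifies the basis of `C'` with the basis elements of `C` other than `[σ]`, `[τ]`: the entry
`a_{τσ}` is invertible, the standard change of basis is made around it, and in the matrix of the
differential with respect to the new basis the rows and columns of `[σ]`, `[τ]` are deleted. -/
def IsStandardCancellation (C : BasedComplex K X B) (σ τ : B) (C' : BasedComplex K X B')
    (f : B' → B) : Prop :=
  C.hdeg σ = C.hdeg τ + 1 ∧ IsUnit (C.entry τ σ) ∧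
  Function.Injective f ∧ Set.range f = {σ, τ}ᶜ ∧
  (∀ b, C'.hdeg b = C.hdeg (f b)) ∧ (∀ b, C'.mdeg b = C.mdeg (f b)) ∧
  ∃ e : Module.Basis B (MvPolynomial X K) (B →₀ MvPolynomial X K),
    (∀ b, e b = C.standardChange σ τ b) ∧
    ∀ b c, C'.entry c b = e.repr (C.d (e (f b))) (f c)

/-- `C.CancelsTo L C' f`: starting with `C`, it is possible to make one after the other the
standard cancellations `0 → S[σ] → S[τ] → 0` for the pairs `(σ, τ)` of the list `L`, in this order,
and `C'` is the result; `f` identifies its basis with a subset of the basis of `C`. -/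
inductive CancelsTo {B : Type} (C : BasedComplex K X B) :
    List (B × B) → {N : Type} → BasedComplex K X N → (N → B) → Prop
  | refl : CancelsTo C [] C id
  | step {L : List (B × B)} {N N' : Type} {C' : BasedComplex K X N} {f : N → B} {σ τ : N}
      {C'' : BasedComplex K X N'} {g : N' → N} (h : CancelsTo C L C' f)
      (hc : C'.IsStandardCancellation σ τ C'' g) :
      CancelsTo C (L ++ [(f σ, f τ)]) C'' (f ∘ g)

end BasedComplex

/-! ### The Taylor resolution -/

/-- The Taylor complex of the monomials `l 0, …, l (r - 1)`, with basis the full simplex: the subset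
`s` is the basis element `[l i : i ∈ s]`, of multidegree `lcm (l i : i ∈ s)`, and
`d [s] = ∑_{i ∈ s} ± (mdeg [s] / mdeg [s \ i]) [s \ i]`, where the sign is `-1` to the number of
elements of `s` that precede `i`. -/
noncomputable def taylor (K : Type*) {X : Type*} [Field K] {r : ℕ} (l : Fin r → X →₀ ℕ) :
    BasedComplex K X (Finset (Fin r)) where
  hdeg s := s.card
  mdeg s := s.sup l
  d := Finsupp.linearCombination (MvPolynomial X K) (fun s => ∑ i ∈ s,
    Finsupp.single (s.erase i)
      (monomial (s.sup l - (s.erase i).sup l) ((-1 : K) ^ (s.filter (· < i)).card)))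

/-- The set `A` of pairs `([m_{i_1}, …, m_{i_j}, n], [m_{i_1}, …, m_{i_j}])` with
`n ∣ lcm (m_{i_1}, …, m_{i_j})`, where `n = l k` and the `m_i` are the other `l i`. -/
def cancellationPairs {X : Type*} {r : ℕ} (l : Fin r → X →₀ ℕ) (k : Fin r) :
    Set (Finset (Fin r) × Finset (Fin r)) :=
  {p | k ∉ p.2 ∧ l k ≤ p.2.sup l ∧ p.1 = insert k p.2}

/-! Everything rests on one consequence of dominance. If `x ^ e` divides a dominant generator and no
other generator, then it divides the lcm of a set of generators exactly when the set contains that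
generator. So `s.sup l` determines `s.erase k`, and two distinct basis elements of the Taylor
complex with the same multidegree form a pair of `A` (`mem_cancellationPairs_of_sup_eq`). A
homogeneous entry has a constant term only between equal multidegrees, so the nonzero constant terms
of the Taylor differential sit exactly at the pairs of `A`, where the entry is a sign.

Cancellations. With `h` the map `[τ] ↦ c⁻¹ [σ]`, a standard cancellation is the retraction of the
complex onto the image of `1 - hd - dh`, so it preserves resolutions (`isResolutionWith_cancel`). It
changes the entry at `(s, t)` by `a_{τs} a_{tσ} / a_{τσ}` (`cancel_entry`). At another pair of `A` a
nonzero correction would force all four multidegrees to agree, although a pair is determined by its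
multidegree. Hence the remaining pairs keep their constant entries and the order is irrelevant. At
the end the multidegrees are distinct, so no entry has a constant term and the resolution is
minimal.

Splitting. This half does not go through the cancellations. Given any minimal resolution `F`, take
comparison maps `f : T → F` and `g : F → T`, and the chain map `π` from `T` to the trivial complexes
with coordinates `x_τ` and `(d x)_τ`. The map `(f, π)` is a multigraded chain map, and it is
bijective modulo the variables: there `d` on `F` vanishes, `d` on `T` is `[σ] ↦ c [τ]`, and the
homotopies between `gf`, `fg` and the identities do the rest. Graded Nakayama
(`bijective_of_residue`) makes it an isomorphism.

Comparison maps require the Taylor complex to be exact. In each multidegree it is the chain complex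
of a full simplex, contracted by a cone (`taylor_exists_d_eq`). -/

namespace BasedComplex

variable {K X B B' : Type*} [Field K]

/-! ### Homogeneous elements -/

section Homogeneous

variable {C : BasedComplex K X B} {C' : BasedComplex K X B'} {j j' : ℕ} {a a' : X →₀ ℕ}

/-- A zero coordinate is also a scalar multiple of the required monomial, so sums can be treated
coordinate by coordinate. -/
theorem isHomogeneous_iff {x : B →₀ MvPolynomial X K} :
    C.IsHomogeneous j a x ↔ ∀ b, (x b ≠ 0 → C.hdeg b = j ∧ C.mdeg b ≤ a) ∧
      ∃ c : K, x b = monomial (a - C.mdeg b) c := by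
  refine ⟨fun h b => ⟨fun hb => ⟨(h b hb).1, (h b hb).2.1⟩, ?_⟩,
    fun h b hb => ⟨((h b).1 hb).1, ((h b).1 hb).2, (h b).2⟩⟩
  by_cases hb : x b = 0
  · exact ⟨0, by simp [hb]⟩
  · exact (h b hb).2.2

theorem isHomogeneous_zero : C.IsHomogeneous j a 0 := fun _ hb => absurd rfl hb

theorem IsHomogeneous.add {x y : B →₀ MvPolynomial X K} (hx : C.IsHomogeneous j a x)
    (hy : C.IsHomogeneous j a y) : C.IsHomogeneous j a (x + y) := by
  rw [isHomogeneous_iff] at *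
  intro b
  obtain ⟨h1, c, hc⟩ := hx b
  obtain ⟨h2, c', hc'⟩ := hy b
  refine ⟨fun hb => ?_, c + c', by simp [hc, hc']⟩
  by_cases h : x b = 0
  · exact h2 (by simpa [h] using hb)
  · exact h1 h

theorem IsHomogeneous.monomial_smul {x : B →₀ MvPolynomial X K} (hx : C.IsHomogeneous j a x)
    (u : X →₀ ℕ) (k : K) : C.IsHomogeneous j (u + a) (monomial u k • x) := by
  intro b hb
  have hb' : x b ≠ 0 := fun h => hb (by simp [h])
  obtain ⟨h1, h2, c, hc⟩ := hx b hb'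
  refine ⟨h1, h2.trans le_add_self, k * c, ?_⟩
  rw [Finsupp.smul_apply, hc, smul_eq_mul, monomial_mul, add_tsub_assoc_of_le h2]

theorem IsHomogeneous.C_smul {x : B →₀ MvPolynomial X K} (hx : C.IsHomogeneous j a x)
    (k : K) : C.IsHomogeneous j a ((MvPolynomial.C k : MvPolynomial X K) • x) := by
  simpa using hx.monomial_smul 0 k

theorem IsHomogeneous.neg {x : B →₀ MvPolynomial X K} (hx : C.IsHomogeneous j a x) :
    C.IsHomogeneous j a (-x) := by
  simpa using hx.C_smul (-1)

theorem IsHomogeneous.sub {x y : B →₀ MvPolynomial X K} (hx : C.IsHomogeneous j a x)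
    (hy : C.IsHomogeneous j a y) : C.IsHomogeneous j a (x - y) := by
  simpa [sub_eq_add_neg] using hx.add hy.neg

theorem isHomogeneous_sum {ι : Type*} (s : Finset ι) (x : ι → B →₀ MvPolynomial X K)
    (h : ∀ i ∈ s, C.IsHomogeneous j a (x i)) : C.IsHomogeneous j a (∑ i ∈ s, x i) :=
  Finset.sum_induction _ _ (fun _ _ => IsHomogeneous.add) isHomogeneous_zero h

theorem isHomogeneous_single {b : B} (hj : C.hdeg b = j) (ha : C.mdeg b ≤ a) (k : K) :
    C.IsHomogeneous j a (Finsupp.single b (monomial (a - C.mdeg b) k)) := by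
  intro c hc
  obtain rfl : b = c := by
    by_contra h
    exact hc (by simp [h])
  exact ⟨hj, ha, k, by simp⟩

theorem isHomogeneous_single_one (b : B) :
    C.IsHomogeneous (C.hdeg b) (C.mdeg b) (Finsupp.single b 1) := by
  simpa using isHomogeneous_single (C := C) rfl le_rfl (1 : K) (b := b)

theorem IsHomogeneous.mem_chains {x : B →₀ MvPolynomial X K} (hx : C.IsHomogeneous j a x) :
    x ∈ C.chains j := by
  intro b hb
  exact (hx b (by simpa using hb)).1

theorem apply_eq_sum (φ : (B →₀ MvPolynomial X K) →ₗ[MvPolynomial X K] (B' →₀ MvPolynomial X K))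
    (x : B →₀ MvPolynomial X K) :
    φ x = ∑ b ∈ x.support, x b • φ (Finsupp.single b 1) := by
  conv_lhs => rw [← Finsupp.sum_single x]
  rw [Finsupp.sum, map_sum]
  refine Finset.sum_congr rfl fun b _ => ?_
  rw [← map_smul, Finsupp.smul_single, smul_eq_mul, mul_one]

theorem IsHomogeneous.map {x : B →₀ MvPolynomial X K} (hx : C.IsHomogeneous j a x)
    {φ : (B →₀ MvPolynomial X K) →ₗ[MvPolynomial X K] (B' →₀ MvPolynomial X K)}
    (hφ : ∀ b, C.hdeg b = j → C'.IsHomogeneous j' (C.mdeg b) (φ (Finsupp.single b 1))) :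
    C'.IsHomogeneous j' a (φ x) := by
  rw [apply_eq_sum]
  refine isHomogeneous_sum _ _ fun b hb => ?_
  obtain ⟨h1, h2, c, hc⟩ := hx b (by simpa using hb)
  rw [hc]
  simpa [tsub_add_cancel_of_le h2] using (hφ b h1).monomial_smul (a - C.mdeg b) c

/-- Two linear maps that agree on the basis elements of homological degree `j` agree on the chains
of that degree. -/
theorem eq_of_mem_chains {W : Type*} [AddCommMonoid W] [Module (MvPolynomial X K) W]
    {φ ψ : (B →₀ MvPolynomial X K) →ₗ[MvPolynomial X K] W}
    (h : ∀ b, C.hdeg b = j → φ (Finsupp.single b 1) = ψ (Finsupp.single b 1))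
    {x : B →₀ MvPolynomial X K} (hx : x ∈ C.chains j) : φ x = ψ x := by
  rw [chains, Finsupp.supported_eq_span_single] at hx
  have : Set.EqOn φ ψ ((fun i => Finsupp.single i (1 : MvPolynomial X K)) '' {b | C.hdeg b = j}) := by
    rintro _ ⟨b, hb, rfl⟩
    exact h b hb
  exact LinearMap.eqOn_span this hx

theorem chains_induction {P : (B →₀ MvPolynomial X K) → Prop} (h0 : P 0)
    (hadd : ∀ x y, P x → P y → P (x + y))
    (hom : ∀ a x, C.IsHomogeneous j a x → P x) {x : B →₀ MvPolynomial X K}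
    (hx : x ∈ C.chains j) : P x := by
  rw [← Finsupp.sum_single x]
  refine Finset.sum_induction _ P hadd h0 fun b hb => ?_
  have hj : C.hdeg b = j := hx (by simpa using hb)
  generalize x b = p
  induction p using MvPolynomial.induction_on' with
  | monomial u c =>
    refine hom (u + C.mdeg b) _ ?_
    simpa using isHomogeneous_single (C := C) hj (a := u + C.mdeg b) le_add_self c
  | add p q hp hq =>
    rw [Finsupp.single_add]
    exact hadd _ _ hp hq

theorem map_mem_chains {φ : (B →₀ MvPolynomial X K) →ₗ[MvPolynomial X K] (B' →₀ MvPolynomial X K)}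
    (hφ : ∀ b, C.hdeg b = j → φ (Finsupp.single b 1) ∈ C'.chains j')
    {x : B →₀ MvPolynomial X K} (hx : x ∈ C.chains j) : φ x ∈ C'.chains j' := by
  rw [apply_eq_sum]
  exact Submodule.sum_mem _ fun b hb => Submodule.smul_mem _ _ (hφ b (hx (by simpa using hb)))

end Homogeneous

/-! ### Homogeneous components -/

section Component

open Classical in
/-- The component of `x` in homological degree `j` and multidegree `a`. -/
noncomputable def component (C : BasedComplex K X B) (j : ℕ) (a : X →₀ ℕ) :
    (B →₀ MvPolynomial X K) →+ (B →₀ MvPolynomial X K) where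
  toFun x := Finsupp.onFinset x.support
    (fun b => if C.hdeg b = j ∧ C.mdeg b ≤ a then
      monomial (a - C.mdeg b) (coeff (a - C.mdeg b) (x b)) else 0) (by
      intro b hb
      by_contra h
      simp at h
      simp [h] at hb)
  map_zero' := by ext1 b; simp
  map_add' x y := by ext1 b; simp only [Finsupp.onFinset_apply, Finsupp.add_apply]; split_ifs <;> simp

variable {C : BasedComplex K X B} {C' : BasedComplex K X B'} {j j' : ℕ} {a a' : X →₀ ℕ}

open Classical in
theorem component_apply (x : B →₀ MvPolynomial X K) (b : B) :
    C.component j a x b = if C.hdeg b = j ∧ C.mdeg b ≤ a then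
      monomial (a - C.mdeg b) (coeff (a - C.mdeg b) (x b)) else 0 := rfl

theorem isHomogeneous_component (x : B →₀ MvPolynomial X K) :
    C.IsHomogeneous j a (C.component j a x) := by
  intro b hb
  rw [component_apply] at hb ⊢
  split_ifs at hb ⊢ with h
  · exact ⟨h.1, h.2, _, rfl⟩
  · exact absurd rfl hb

theorem IsHomogeneous.component_eq {x : B →₀ MvPolynomial X K} (hx : C.IsHomogeneous j a x) :
    C.component j a x = x := by
  ext1 b
  rw [component_apply]
  by_cases hb : x b = 0
  · simp [hb]
  · classical
    obtain ⟨h1, h2, c, hc⟩ := hx b hb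
    rw [if_pos ⟨h1, h2⟩, hc, coeff_monomial, if_pos rfl]

theorem IsHomogeneous.component_eq_zero {x : B →₀ MvPolynomial X K} (hx : C.IsHomogeneous j a' x)
    (h : a' ≠ a) : C.component j a x = 0 := by
  ext1 b
  rw [component_apply]
  split_ifs with hab
  · by_cases hb : x b = 0
    · simp [hb]
    · classical
      obtain ⟨h1, h2, c, hc⟩ := hx b hb
      rw [hc, coeff_monomial, if_neg, monomial_zero]
      · rfl
      · intro he
        exact h ((tsub_left_inj h2 hab.2).1 he)
  · rfl

theorem map_component
    {φ : (B →₀ MvPolynomial X K) →ₗ[MvPolynomial X K] (B' →₀ MvPolynomial X K)}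
    (hφ : ∀ b, C.hdeg b = j → C'.IsHomogeneous j' (C.mdeg b) (φ (Finsupp.single b 1)))
    {x : B →₀ MvPolynomial X K} (hx : x ∈ C.chains j) :
    φ (C.component j a x) = C'.component j' a (φ x) := by
  refine chains_induction (P := fun x => φ (C.component j a x) = C'.component j' a (φ x)) (by simp)
    (fun x y h1 h2 => by simp [h1, h2]) (fun a' x hx => ?_) hx
  by_cases h : a' = a
  · subst h
    rw [hx.component_eq, (hx.map hφ).component_eq]
  · rw [hx.component_eq_zero h, (hx.map hφ).component_eq_zero h, map_zero]

theorem exists_eq_sum_component {x : B →₀ MvPolynomial X K} (hx : x ∈ C.chains j) :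
    ∃ A : Finset (X →₀ ℕ), x = ∑ a ∈ A, C.component j a x := by
  classical
  suffices h : ∃ A : Finset (X →₀ ℕ), ∀ A', A ⊆ A' → x = ∑ a ∈ A', C.component j a x from
    h.imp fun A hA => hA A subset_rfl
  refine chains_induction (P := fun x => ∃ A : Finset (X →₀ ℕ),
    ∀ A', A ⊆ A' → x = ∑ a ∈ A', C.component j a x) ⟨∅, by simp⟩ ?_ ?_ hx
  · rintro x y ⟨A, hA⟩ ⟨A', hA'⟩
    refine ⟨A ∪ A', fun A'' h => ?_⟩
    simp only [map_add, Finset.sum_add_distrib]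
    rw [← hA _ (Finset.union_subset_left h), ← hA' _ (Finset.union_subset_right h)]
  · intro a x hx
    refine ⟨{a}, fun A' h => ?_⟩
    rw [Finset.sum_eq_single a, hx.component_eq]
    · exact fun a' _ h' => hx.component_eq_zero h'.symm
    · exact fun h' => absurd (h (by simp)) h'

end Component

/-- The entry is a scalar times the monomial of exponent `mdeg s - mdeg t`, which has a constant
term only if this exponent is zero. -/
theorem IsComplex.of_constantCoeff_ne_zero {C : BasedComplex K X B} (hC : C.IsComplex) {s t : B}
    (h : constantCoeff (C.d (Finsupp.single s 1) t) ≠ 0) :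
    C.hdeg s = C.hdeg t + 1 ∧ C.mdeg s = C.mdeg t := by
  classical
  cases hs : C.hdeg s with
  | zero => simp [hC.d_zero s hs] at h
  | succ j =>
    obtain ⟨h1, h2, c, hc⟩ := hC.d_homogeneous s j hs t fun h0 => h (by simp [h0])
    refine ⟨by rw [h1], le_antisymm ?_ h2⟩
    rw [hc, constantCoeff_eq, coeff_monomial] at h
    exact tsub_eq_zero_iff_le.1 (of_not_not fun hne => h (if_neg hne))

/-! ### Resolutions with a chosen augmentation -/

theorem IsComplex.d_d {C : BasedComplex K X B} (hC : C.IsComplex) (x : B →₀ MvPolynomial X K) :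
    C.d (C.d x) = 0 := LinearMap.congr_fun hC.d_comp_d x

theorem IsComplex.isHomogeneous_d {C : BasedComplex K X B} (hC : C.IsComplex) {j : ℕ} {a : X →₀ ℕ}
    {x : B →₀ MvPolynomial X K} (hx : C.IsHomogeneous (j + 1) a x) : C.IsHomogeneous j a (C.d x) :=
  hx.map fun b hb => hC.d_homogeneous b j hb

theorem IsComplex.d_mem_chains {C : BasedComplex K X B} (hC : C.IsComplex) {j : ℕ}
    {x : B →₀ MvPolynomial X K} (hx : x ∈ C.chains (j + 1)) : C.d x ∈ C.chains j :=
  map_mem_chains (fun b hb => (hC.d_homogeneous b j hb).mem_chains) hx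

theorem IsComplex.d_eq_zero {C : BasedComplex K X B} (hC : C.IsComplex)
    {x : B →₀ MvPolynomial X K} (hx : x ∈ C.chains 0) : C.d x = 0 :=
  eq_of_mem_chains (ψ := 0) (fun b hb => by simpa using hC.d_zero b hb) hx

/-- `C` is a multigraded free resolution of `S / M` with augmentation `ε`. -/
structure IsResolutionWith (C : BasedComplex K X B) (M : Ideal (MvPolynomial X K))
    (ε : (B →₀ MvPolynomial X K) →ₗ[MvPolynomial X K] (MvPolynomial X K ⧸ M)) : Prop where
  isComplex : C.IsComplex
  homogeneous : ∀ b, C.hdeg b = 0 →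
      ∃ c : K, ε (Finsupp.single b 1) = Ideal.Quotient.mk M (monomial (C.mdeg b) c)
  map_eq_top : (C.chains 0).map ε = ⊤
  ker_zero : LinearMap.ker ε ⊓ C.chains 0 = (C.chains 1).map C.d
  ker_succ : ∀ j, LinearMap.ker C.d ⊓ C.chains (j + 1) = (C.chains (j + 2)).map C.d

theorem isFreeResolution_iff {C : BasedComplex K X B} {M : Ideal (MvPolynomial X K)} :
    C.IsFreeResolution M ↔ ∃ ε, C.IsResolutionWith M ε :=
  ⟨fun ⟨h, ε, h1, h2, h3, h4⟩ => ⟨ε, h, h1, h2, h3, h4⟩,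
    fun ⟨ε, h, h1, h2, h3, h4⟩ => ⟨h, ε, h1, h2, h3, h4⟩⟩

theorem coeff_mem_of_isMonomialIdeal {M : Ideal (MvPolynomial X K)} (hM : IsMonomialIdeal M)
    {p : MvPolynomial X K} (hp : p ∈ M) (a : X →₀ ℕ) : monomial a (coeff a p) ∈ M := by
  classical
  obtain ⟨E, rfl⟩ := hM
  by_cases ha : coeff a p = 0
  · simp [ha]
  rw [mem_ideal_span_monomial_image] at hp ⊢
  intro b hb
  have : b = a := by
    by_contra h
    rw [mem_support_iff, coeff_monomial, if_neg (Ne.symm h)] at hb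
    exact hb rfl
  subst this
  exact hp b (by simpa using ha)

namespace IsResolutionWith

variable {C : BasedComplex K X B} {M : Ideal (MvPolynomial X K)}
  {ε : (B →₀ MvPolynomial X K) →ₗ[MvPolynomial X K] (MvPolynomial X K ⧸ M)}

theorem augmentation_d (h : C.IsResolutionWith M ε) {x : B →₀ MvPolynomial X K}
    (hx : x ∈ C.chains 1) : ε (C.d x) = 0 := by
  have : C.d x ∈ (C.chains 1).map C.d := ⟨x, hx, rfl⟩
  rw [← h.ker_zero] at this
  exact this.1

/-- Exactness in multigraded form: `C.d` commutes with taking components, so any preimage can be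
replaced by its component of multidegree `a`. -/
theorem exists_d_eq (h : C.IsResolutionWith M ε) {j : ℕ} {a : X →₀ ℕ}
    {z : B →₀ MvPolynomial X K} (hz : C.IsHomogeneous j a z) (hd : C.d z = 0)
    (hε : j = 0 → ε z = 0) : ∃ y, C.IsHomogeneous (j + 1) a y ∧ C.d y = z := by
  obtain ⟨y, hy, rfl⟩ : z ∈ (C.chains (j + 1)).map C.d := by
    cases j with
    | zero => rw [← h.ker_zero]; exact ⟨hε rfl, hz.mem_chains⟩
    | succ j => rw [← h.ker_succ]; exact ⟨hd, hz.mem_chains⟩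
  refine ⟨C.component (j + 1) a y, isHomogeneous_component y, ?_⟩
  rw [map_component (fun b hb => h.isComplex.d_homogeneous b j hb) hy, hz.component_eq]

theorem exists_augmentation_eq_of_isHomogeneous (h : C.IsResolutionWith M ε) {a : X →₀ ℕ}
    {y : B →₀ MvPolynomial X K} (hy : C.IsHomogeneous 0 a y) :
    ∃ k : K, ε y = Ideal.Quotient.mk M (monomial a k) := by
  rw [← Finsupp.sum_single y, Finsupp.sum, map_sum]
  refine Finset.sum_induction _ (fun t => ∃ k : K, t = Ideal.Quotient.mk M (monomial a k))
    ?_ ⟨0, by simp⟩ fun b hb => ?_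
  · rintro _ _ ⟨k, rfl⟩ ⟨k', rfl⟩
    exact ⟨k + k', by simp⟩
  · obtain ⟨h1, h2, c, hc⟩ := hy b (by simpa using hb)
    obtain ⟨k, hk⟩ := h.homogeneous b h1
    refine ⟨c * k, ?_⟩
    have : Finsupp.single b (y b) = y b • Finsupp.single b (1 : MvPolynomial X K) := by simp
    rw [this, map_smul, hk, hc, ← Ideal.Quotient.mk_eq_mk, ← Submodule.Quotient.mk_smul,
      smul_eq_mul, monomial_mul, tsub_add_cancel_of_le h2, Ideal.Quotient.mk_eq_mk]

/-- One representative `p` serves all multidegrees at once; its terms represent the images of the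
components of `y`. -/
theorem exists_augmentation_eq (h : C.IsResolutionWith M ε) {y : B →₀ MvPolynomial X K}
    (hy : y ∈ C.chains 0) : ∃ p, ε y = Ideal.Quotient.mk M p ∧
      ∀ a, ε (C.component 0 a y) = Ideal.Quotient.mk M (monomial a (coeff a p)) := by
  classical
  refine chains_induction (P := fun y => ∃ p, ε y = Ideal.Quotient.mk M p ∧
    ∀ a, ε (C.component 0 a y) = Ideal.Quotient.mk M (monomial a (coeff a p))) ⟨0, by simp⟩ ?_ ?_ hy
  · rintro x y ⟨p, hp, hp'⟩ ⟨q, hq, hq'⟩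
    exact ⟨p + q, by simp [hp, hq], fun a => by simp [hp', hq']⟩
  · intro a y hy
    obtain ⟨k, hk⟩ := h.exists_augmentation_eq_of_isHomogeneous hy
    refine ⟨_, hk, fun a' => ?_⟩
    by_cases ha : a = a'
    · subst ha
      rw [hy.component_eq, hk, coeff_monomial, if_pos rfl]
    · rw [hy.component_eq_zero ha, coeff_monomial, if_neg ha, monomial_zero, map_zero, map_zero]

/-- A monomial ideal contains every term of its elements, so the congruence satisfied by an
arbitrary preimage can be read in multidegree `a` alone. -/
theorem exists_isHomogeneous_augmentation_eq (h : C.IsResolutionWith M ε) (hM : IsMonomialIdeal M)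
    (a : X →₀ ℕ) (k : K) :
    ∃ y, C.IsHomogeneous 0 a y ∧ ε y = Ideal.Quotient.mk M (monomial a k) := by
  obtain ⟨y, hy, hyk⟩ : Ideal.Quotient.mk M (monomial a k) ∈ (C.chains 0).map ε := by
    rw [h.map_eq_top]; trivial
  obtain ⟨p, hp, hpa⟩ := h.exists_augmentation_eq hy
  refine ⟨_, isHomogeneous_component y, (hpa a).trans ?_⟩
  rw [hp, Ideal.Quotient.eq] at hyk
  rw [Ideal.Quotient.eq]
  classical
  simpa only [coeff_sub, coeff_monomial, if_pos, map_sub] using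
    coeff_mem_of_isMonomialIdeal hM hyk a

end IsResolutionWith

/-! ### Comparison maps and homotopies -/

section Comparison

variable {C : BasedComplex K X B} {C' : BasedComplex K X B'}

/-- The recursion on homological degree shared by comparison maps and homotopies: `Q b z y` says
that `y` is an admissible value at `[b]` when the image of `d [b]` is `z`. -/
theorem exists_linearMap_of_step (hC : C.IsComplex)
    (Q : B → (B' →₀ MvPolynomial X K) → (B' →₀ MvPolynomial X K) → Prop)
    (h0 : ∀ b, C.hdeg b = 0 → ∃ y, Q b 0 y)
    (hs : ∀ b j, C.hdeg b = j + 1 →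
      ∀ φ : (B →₀ MvPolynomial X K) →ₗ[MvPolynomial X K] (B' →₀ MvPolynomial X K),
        (∀ c, C.hdeg c ≤ j → Q c (φ (C.d (Finsupp.single c 1))) (φ (Finsupp.single c 1))) →
        ∃ y, Q b (φ (C.d (Finsupp.single b 1))) y) :
    ∃ φ : (B →₀ MvPolynomial X K) →ₗ[MvPolynomial X K] (B' →₀ MvPolynomial X K),
      ∀ b, Q b (φ (C.d (Finsupp.single b 1))) (φ (Finsupp.single b 1)) := by
  classical
  let lin : (B → (B' →₀ MvPolynomial X K)) →
      ((B →₀ MvPolynomial X K) →ₗ[MvPolynomial X K] (B' →₀ MvPolynomial X K)) :=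
    Finsupp.linearCombination (MvPolynomial X K)
  have lin_single : ∀ f b, lin f (Finsupp.single b 1) = f b := fun f b => by simp [lin]
  -- `seq j` is meaningful only up to homological degree `j`; higher basis elements carry
  -- provisional values, overwritten when their degree is reached.
  let seq : ℕ → (B → (B' →₀ MvPolynomial X K)) := fun j => Nat.rec
    (fun b => if h : ∃ y, Q b 0 y then h.choose else 0)
    (fun j f b => if h : C.hdeg b = j + 1 ∧ ∃ y, Q b (lin f (C.d (Finsupp.single b 1))) y
      then h.2.choose else f b) j
  have seq_zero : ∀ b, seq 0 b = if h : ∃ y, Q b 0 y then h.choose else 0 := fun _ => rfl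
  have seq_succ : ∀ j b, seq (j + 1) b =
      if h : C.hdeg b = j + 1 ∧ ∃ y, Q b (lin (seq j) (C.d (Finsupp.single b 1))) y
      then h.2.choose else seq j b := fun _ _ => rfl
  have seq_succ_of_le : ∀ j b, C.hdeg b ≤ j → seq (j + 1) b = seq j b := by
    intro j b hb
    rw [seq_succ, dif_neg]
    intro h
    omega
  have lin_congr : ∀ (f g : B → (B' →₀ MvPolynomial X K)) (j : ℕ), (∀ c, C.hdeg c ≤ j → f c = g c) →
      ∀ b, C.hdeg b ≤ j + 1 → lin f (C.d (Finsupp.single b 1)) = lin g (C.d (Finsupp.single b 1)) := by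
    intro f g j hfg b hb
    cases hb' : C.hdeg b with
    | zero => rw [hC.d_zero b hb', map_zero, map_zero]
    | succ i =>
      refine eq_of_mem_chains (C := C) (j := i) (fun c hc => ?_)
        (hC.d_homogeneous b i hb').mem_chains
      rw [lin_single, lin_single]
      exact hfg c (by omega)
  have key : ∀ j b, C.hdeg b ≤ j → Q b (lin (seq j) (C.d (Finsupp.single b 1))) (seq j b) := by
    intro j
    induction j with
    | zero =>
      intro b hb
      have hb0 : C.hdeg b = 0 := by omega
      rw [hC.d_zero b hb0, map_zero, seq_zero, dif_pos (h0 b hb0)]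
      exact (h0 b hb0).choose_spec
    | succ j ih =>
      intro b hb
      rw [lin_congr (seq (j + 1)) (seq j) j (seq_succ_of_le j) b hb]
      by_cases hbj : C.hdeg b ≤ j
      · rw [seq_succ_of_le j b hbj]
        exact ih b hbj
      · have hb1 : C.hdeg b = j + 1 := by omega
        have h := hs b j hb1 (lin (seq j)) (fun c hc => by rw [lin_single]; exact ih c hc)
        rw [seq_succ, dif_pos ⟨hb1, h⟩]
        exact h.choose_spec
  have seq_stable : ∀ j b, C.hdeg b ≤ j → seq j b = seq (C.hdeg b) b := by
    intro j b hb
    induction j, hb using Nat.le_induction with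
    | base => rfl
    | succ j hj ih => rw [seq_succ_of_le j b hj, ih]
  refine ⟨lin fun b => seq (C.hdeg b) b, fun b => ?_⟩
  rw [lin_single, lin_congr _ (seq (C.hdeg b)) (C.hdeg b) (fun c hc => (seq_stable _ c hc).symm) b
    (by omega)]
  exact key _ b le_rfl

variable {M : Ideal (MvPolynomial X K)}
  {ε : (B →₀ MvPolynomial X K) →ₗ[MvPolynomial X K] (MvPolynomial X K ⧸ M)}
  {ε' : (B' →₀ MvPolynomial X K) →ₗ[MvPolynomial X K] (MvPolynomial X K ⧸ M)}

/-- Between two multigraded free resolutions there is a multigraded chain map that is compatible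
with the augmentations. -/
theorem exists_comparison (hM : IsMonomialIdeal M) (hC : C.IsResolutionWith M ε)
    (hC' : C'.IsResolutionWith M ε') :
    ∃ φ : (B →₀ MvPolynomial X K) →ₗ[MvPolynomial X K] (B' →₀ MvPolynomial X K),
      (∀ b, C'.IsHomogeneous (C.hdeg b) (C.mdeg b) (φ (Finsupp.single b 1))) ∧
      (∀ x, φ (C.d x) = C'.d (φ x)) ∧ ∀ x ∈ C.chains 0, ε' (φ x) = ε x := by
  refine (exists_linearMap_of_step hC.isComplex
    (fun b z y => C'.IsHomogeneous (C.hdeg b) (C.mdeg b) y ∧ C'.d y = z ∧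
      (C.hdeg b = 0 → ε' y = ε (Finsupp.single b 1))) ?_ ?_).elim fun φ hφ => ?_
  · intro b hb
    obtain ⟨c, hc⟩ := hC.homogeneous b hb
    obtain ⟨y, hy, hyc⟩ := hC'.exists_isHomogeneous_augmentation_eq hM (C.mdeg b) c
    exact ⟨y, by rwa [hb], hC'.isComplex.d_eq_zero hy.mem_chains, fun _ => by rw [hyc, hc]⟩
  · intro b j hb φ hφ
    have hdb := hC.isComplex.d_homogeneous b j hb
    have hd : C'.d (φ (C.d (Finsupp.single b 1))) = 0 := by
      have := eq_of_mem_chains (φ := C'.d ∘ₗ φ) (ψ := φ ∘ₗ C.d)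
        (fun c hc => (hφ c hc.le).2.1) hdb.mem_chains
      simpa [hC.isComplex.d_d] using this
    have hε : j = 0 → ε' (φ (C.d (Finsupp.single b 1))) = 0 := by
      rintro rfl
      have := eq_of_mem_chains (φ := ε' ∘ₗ φ) (ψ := ε)
        (fun c hc => (hφ c hc.le).2.2 hc) hdb.mem_chains
      rw [LinearMap.comp_apply] at this
      rw [this]
      exact hC.augmentation_d (by simpa [hb] using (isHomogeneous_single_one (C := C) b).mem_chains)
    obtain ⟨y, hy, hyd⟩ := hC'.exists_d_eq
      (hdb.map fun c hc => by simpa [hc] using (hφ c hc.le).1) hd hε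
    exact ⟨y, by rwa [hb], hyd, fun h => by omega⟩
  · refine ⟨φ, fun b => (hφ b).1, fun x => ?_, fun x hx => ?_⟩
    · refine LinearMap.congr_fun (f := φ ∘ₗ C.d) (g := C'.d ∘ₗ φ) (Finsupp.lhom_ext' fun b => ?_) x
      ext1
      simpa using (hφ b).2.1.symm
    · exact eq_of_mem_chains (φ := ε' ∘ₗ φ) (fun b hb => (hφ b).2.2 hb) hx

/-- A multigraded chain map to a resolution that vanishes on the augmentation is null-homotopic. -/
theorem exists_homotopy (hC : C.IsComplex) (hC' : C'.IsResolutionWith M ε')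
    (w : (B →₀ MvPolynomial X K) →ₗ[MvPolynomial X K] (B' →₀ MvPolynomial X K))
    (hw : ∀ b, C'.IsHomogeneous (C.hdeg b) (C.mdeg b) (w (Finsupp.single b 1)))
    (hwd : ∀ x, w (C.d x) = C'.d (w x)) (hwε : ∀ x ∈ C.chains 0, ε' (w x) = 0) :
    ∃ h : (B →₀ MvPolynomial X K) →ₗ[MvPolynomial X K] (B' →₀ MvPolynomial X K),
      ∀ x, C'.d (h x) + h (C.d x) = w x := by
  refine (exists_linearMap_of_step hC
    (fun b z y => C'.IsHomogeneous (C.hdeg b + 1) (C.mdeg b) y ∧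
      C'.d y = w (Finsupp.single b 1) - z) ?_ ?_).elim fun h hh => ?_
  · intro b hb
    have h1 := hw b
    rw [hb] at h1
    have hb' := (isHomogeneous_single_one (C := C) b).mem_chains
    rw [hb] at hb'
    obtain ⟨y, hy, hyd⟩ := hC'.exists_d_eq h1
      (hC'.isComplex.d_eq_zero h1.mem_chains) fun _ => hwε _ hb'
    exact ⟨y, by rwa [hb], by rw [hyd, sub_zero]⟩
  · intro b j hb φ hφ
    have hdb := hC.d_homogeneous b j hb
    have h1 := hw b
    rw [hb] at h1
    have h2 : C'.IsHomogeneous (j + 1) (C.mdeg b) (φ (C.d (Finsupp.single b 1))) :=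
      hdb.map fun c hc => by simpa [hc] using (hφ c hc.le).1
    -- On `d [b]` the homotopy relation holds by induction, and its term `φ (d (d [b]))` vanishes.
    have hd : C'.d (w (Finsupp.single b 1) - φ (C.d (Finsupp.single b 1))) = 0 := by
      have := eq_of_mem_chains (φ := C'.d ∘ₗ φ) (ψ := w - φ ∘ₗ C.d)
        (fun c hc => (hφ c hc.le).2) hdb.mem_chains
      rw [map_sub, ← hwd, sub_eq_zero]
      simpa [hC.d_d] using this.symm
    obtain ⟨y, hy, hyd⟩ := hC'.exists_d_eq (h1.sub h2) hd (by simp)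
    exact ⟨y, by rwa [hb], hyd⟩
  · refine ⟨h, fun x => ?_⟩
    refine LinearMap.congr_fun (f := C'.d ∘ₗ h + h ∘ₗ C.d) (g := w)
      (Finsupp.lhom_ext' fun b => ?_) x
    ext1
    simpa using eq_sub_iff_add_eq.1 (hh b).2

end Comparison

/-! ### Reduction modulo the variables -/

section Residue

/-- The elements all of whose coordinates have constant coefficient zero. -/
def residueKer (K X B : Type*) [Field K] :
    Submodule (MvPolynomial X K) (B →₀ MvPolynomial X K) where
  carrier := {x | ∀ b, constantCoeff (x b) = 0}
  add_mem' hx hy b := by simp [hx b, hy b]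
  zero_mem' b := by simp
  smul_mem' p x hx b := by simp [hx b]

theorem smul_mem_residueKer {p : MvPolynomial X K} (hp : constantCoeff p = 0)
    (x : B →₀ MvPolynomial X K) : p • x ∈ residueKer K X B := fun b => by simp [hp]

theorem map_mem_residueKer
    (φ : (B →₀ MvPolynomial X K) →ₗ[MvPolynomial X K] (B' →₀ MvPolynomial X K))
    {x : B →₀ MvPolynomial X K} (hx : x ∈ residueKer K X B) : φ x ∈ residueKer K X B' := by
  rw [apply_eq_sum]
  exact Submodule.sum_mem _ fun b _ => smul_mem_residueKer (hx b) _

/-- This is how minimality is used: the differential of a minimal resolution vanishes modulo the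
variables, a condition that can be tested on coordinates. -/
theorem span_X_smul_top_le_residueKer :
    Ideal.span (Set.range (MvPolynomial.X : X → MvPolynomial X K)) •
      (⊤ : Submodule (MvPolynomial X K) (B →₀ MvPolynomial X K)) ≤ residueKer K X B := by
  rw [Submodule.smul_le]
  intro p hp x _
  refine smul_mem_residueKer ?_ x
  have : Ideal.span (Set.range (MvPolynomial.X : X → MvPolynomial X K)) ≤
      RingHom.ker (constantCoeff : MvPolynomial X K →+* K) := by
    rw [Ideal.span_le]
    rintro _ ⟨i, rfl⟩
    simp
  exact this hp

variable {C : BasedComplex K X B} {C' : BasedComplex K X B'}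
  {φ : (B →₀ MvPolynomial X K) →ₗ[MvPolynomial X K] (B' →₀ MvPolynomial X K)}

theorem component_mem_residueKer {x : B →₀ MvPolynomial X K} (hx : x ∈ residueKer K X B) (j : ℕ)
    (a : X →₀ ℕ) : C.component j a x ∈ residueKer K X B := by
  classical
  intro b
  rw [component_apply]
  split_ifs
  · by_cases h : a - C.mdeg b = 0
    · simpa [h, ← constantCoeff_eq] using hx b
    · rw [constantCoeff_eq, coeff_monomial, if_neg h]
  · simp

/-- Multigraded maps commute with taking homogeneous components. -/
theorem component_map (hφ : ∀ b, C'.IsHomogeneous (C.hdeg b) (C.mdeg b) (φ (Finsupp.single b 1)))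
    (j : ℕ) (a : X →₀ ℕ) (x : B →₀ MvPolynomial X K) :
    φ (C.component j a x) = C'.component j a (φ x) := by
  induction x using Finsupp.induction_linear with
  | zero => simp
  | add x y hx hy => simp [hx, hy]
  | single b p =>
    have hb : Finsupp.single b p ∈ C.chains (C.hdeg b) := by
      have := Submodule.smul_mem _ p (isHomogeneous_single_one (C := C) b).mem_chains
      simpa using this
    by_cases h : C.hdeg b = j
    · subst h
      exact map_component (fun c hc => by simpa [hc] using hφ c) hb
    · have aux : ∀ {B : Type _} (C : BasedComplex K X B) (i : ℕ) (x : B →₀ MvPolynomial X K),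
          x ∈ C.chains i → i ≠ j → C.component j a x = 0 := by
        intro B C i x hx hij
        ext1 c
        rw [component_apply]
        by_cases hc : x c = 0
        · simp [hc]
        · have hci : C.hdeg c = i := hx (by simpa using hc)
          rw [if_neg (by omega)]
          rfl
      rw [aux C _ _ hb h, map_zero]
      have : φ (Finsupp.single b p) ∈ C'.chains (C.hdeg b) :=
        map_mem_chains (fun c hc => by simpa [hc] using (hφ c).mem_chains) hb
      ext1 c
      rw [component_apply]
      by_cases hc : φ (Finsupp.single b p) c = 0
      · simp [hc]
      · have hci : C'.hdeg c = C.hdeg b := this (by simpa using hc)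
        rw [if_neg (by omega)]
        rfl

/-- Well-founded induction on multidegrees, so no finiteness of the bases is needed. -/
theorem surjective_of_sup_residueKer
    (hφ : ∀ b, C'.IsHomogeneous (C.hdeg b) (C.mdeg b) (φ (Finsupp.single b 1)))
    (h : ∀ b, Finsupp.single b 1 ∈ LinearMap.range φ ⊔ residueKer K X B') :
    Function.Surjective φ := by
  rw [← LinearMap.range_eq_top, eq_top_iff]
  have key : ∀ (a : X →₀ ℕ) (b : B'), C'.mdeg b = a → Finsupp.single b 1 ∈ LinearMap.range φ := by
    intro a
    induction a using WellFoundedLT.induction with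
    | ind a ih =>
      intro b hb
      obtain ⟨_, ⟨x, rfl⟩, z, hz, hxz⟩ := Submodule.mem_sup.1 (h b)
      have hxz' := congrArg (C'.component (C'.hdeg b) (C'.mdeg b)) hxz
      rw [map_add, ← component_map hφ, (isHomogeneous_single_one b).component_eq] at hxz'
      rw [← hxz']
      refine Submodule.add_mem _ ⟨_, rfl⟩ ?_
      have hz' := component_mem_residueKer (C := C') hz (C'.hdeg b) (C'.mdeg b)
      have hzh := isHomogeneous_component (C := C') (j := C'.hdeg b) (a := C'.mdeg b) z
      generalize C'.component (C'.hdeg b) (C'.mdeg b) z = y at hz' hzh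
      rw [← Finsupp.sum_single y]
      refine Submodule.sum_mem _ fun c hc => ?_
      have hc' : y c ≠ 0 := by simpa using hc
      obtain ⟨h1, h2, k, hk⟩ := hzh c hc'
      -- The error term has no constant coefficients, so it only involves basis elements of strictly
      -- smaller multidegree.
      have hlt : C'.mdeg c < a := by
        refine hb ▸ lt_of_le_of_ne h2 fun he => hc' ?_
        have := hz' c
        rw [hk, he, tsub_self] at this
        rw [hk, he, tsub_self]
        simpa using this
      have := Submodule.smul_mem _ (y c) (ih _ hlt c rfl)
      simpa using this
  intro x _
  rw [← Finsupp.sum_single x]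
  refine Submodule.sum_mem _ fun b _ => ?_
  have := Submodule.smul_mem _ (x b) (key _ b rfl)
  simpa using this

/-- Graded Nakayama lemma: a multigraded map of degree zero between free modules that is bijective
modulo the variables is bijective. -/
theorem bijective_of_residue
    (hφ : ∀ b, C'.IsHomogeneous (C.hdeg b) (C.mdeg b) (φ (Finsupp.single b 1)))
    (hsurj : ∀ b, Finsupp.single b 1 ∈ LinearMap.range φ ⊔ residueKer K X B')
    (hinj : ∀ x, φ x ∈ residueKer K X B' → x ∈ residueKer K X B) :
    Function.Bijective φ := by
  have hs := surjective_of_sup_residueKer hφ hsurj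
  have hsec : ∀ b, ∃ x, C.IsHomogeneous (C'.hdeg b) (C'.mdeg b) x ∧ φ x = Finsupp.single b 1 := by
    intro b
    obtain ⟨x, hx⟩ := hs (Finsupp.single b 1)
    refine ⟨_, isHomogeneous_component x, ?_⟩
    rw [component_map hφ, hx, (isHomogeneous_single_one b).component_eq]
  choose s hs1 hs2 using hsec
  let ψ : (B' →₀ MvPolynomial X K) →ₗ[MvPolynomial X K] (B →₀ MvPolynomial X K) :=
    Finsupp.linearCombination (MvPolynomial X K) s
  have hψ : ∀ b, ψ (Finsupp.single b 1) = s b := fun b => by simp [ψ]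
  have hφψ : ∀ y, φ (ψ y) = y := by
    intro y
    refine LinearMap.congr_fun (f := φ ∘ₗ ψ) (g := LinearMap.id) (Finsupp.lhom_ext' fun b => ?_) y
    ext1
    simp [hψ, hs2]
  -- Injectivity of `φ` modulo the variables makes its section `ψ` surjective modulo the variables,
  -- hence surjective. A map with a surjective section is injective.
  have hψs : Function.Surjective ψ := by
    refine surjective_of_sup_residueKer (C := C') (C' := C) (fun b => by rw [hψ]; exact hs1 b)
      fun b => ?_
    refine Submodule.mem_sup.2 ⟨_, ⟨φ (Finsupp.single b 1), rfl⟩,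
      Finsupp.single b 1 - ψ (φ (Finsupp.single b 1)), ?_, by abel⟩
    apply hinj
    rw [map_sub, hφψ, sub_self]
    exact Submodule.zero_mem _
  refine ⟨fun x y hxy => ?_, hs⟩
  obtain ⟨x, rfl⟩ := hψs x
  obtain ⟨y, rfl⟩ := hψs y
  rw [hφψ, hφψ] at hxy
  rw [hxy]

end Residue

end BasedComplex

/-! ### The chain complex of the full simplex -/

section Simplex

variable {K : Type*} [Field K] {r : ℕ}

theorem map_mem_of_mem_supported {R α W : Type*} [Semiring R] [AddCommMonoid W] [Module R W]
    {s : Set α} {N : Submodule R W} {φ : (α →₀ R) →ₗ[R] W}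
    (h : ∀ i ∈ s, φ (Finsupp.single i 1) ∈ N) {x : α →₀ R} (hx : x ∈ Finsupp.supported R R s) :
    φ x ∈ N := by
  rw [Finsupp.supported_eq_span_single] at hx
  have : Submodule.span R ((fun i => Finsupp.single i (1 : R)) '' s) ≤ N.comap φ := by
    rw [Submodule.span_le]
    rintro _ ⟨i, hi, rfl⟩
    exact h i hi
  exact this hx

theorem eq_of_mem_supported {R α W : Type*} [Semiring R] [AddCommMonoid W] [Module R W]
    {s : Set α} {φ ψ : (α →₀ R) →ₗ[R] W}
    (h : ∀ i ∈ s, φ (Finsupp.single i 1) = ψ (Finsupp.single i 1)) {x : α →₀ R}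
    (hx : x ∈ Finsupp.supported R R s) : φ x = ψ x := by
  rw [Finsupp.supported_eq_span_single] at hx
  refine LinearMap.eqOn_span (s := (fun i => Finsupp.single i (1 : R)) '' s) ?_ hx
  rintro _ ⟨i, hi, rfl⟩
  exact h i hi

/-- The sign of the face opposite to `i` in the boundary of the simplex `s`. -/
def faceSign (K : Type*) [Field K] (s : Finset (Fin r)) (i : Fin r) : K :=
  (-1) ^ (s.filter (· < i)).card

/-- The boundary map of the full simplex. -/
noncomputable def simplexBoundary (K : Type*) [Field K] (r : ℕ) :
    (Finset (Fin r) →₀ K) →ₗ[K] (Finset (Fin r) →₀ K) :=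
  Finsupp.linearCombination K fun s => ∑ i ∈ s, Finsupp.single (s.erase i) (faceSign K s i)

/-- The cone over the vertex `i`. -/
noncomputable def simplexCone (K : Type*) [Field K] (i : Fin r) :
    (Finset (Fin r) →₀ K) →ₗ[K] (Finset (Fin r) →₀ K) :=
  Finsupp.linearCombination K fun s => if i ∈ s then 0 else Finsupp.single (insert i s) 1

theorem simplexBoundary_single (s : Finset (Fin r)) (c : K) :
    simplexBoundary K r (Finsupp.single s c) =
      ∑ i ∈ s, Finsupp.single (s.erase i) (c * faceSign K s i) := by
  simp [simplexBoundary, Finset.smul_sum]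

theorem simplexCone_single (i : Fin r) (s : Finset (Fin r)) (c : K) :
    simplexCone K i (Finsupp.single s c) =
      if i ∈ s then 0 else Finsupp.single (insert i s) c := by
  simp [simplexCone]

theorem faceSign_of_forall_le {s : Finset (Fin r)} {i : Fin r} (h : ∀ x ∈ s, i ≤ x) :
    faceSign K s i = 1 := by
  rw [faceSign, Finset.filter_false_of_mem fun x hx => (h x hx).not_gt]
  simp

/-- Since `i` precedes all other vertices, the face opposite to `i` has sign `1`, and inserting `i`
flips the signs of all other faces, so these cancel. -/
theorem simplexBoundary_cone_single {i : Fin r} {s : Finset (Fin r)} (h : ∀ x ∈ s, i ≤ x) :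
    simplexBoundary K r (simplexCone K i (Finsupp.single s 1)) +
      simplexCone K i (simplexBoundary K r (Finsupp.single s 1)) = Finsupp.single s 1 := by
  rw [simplexBoundary_single, map_sum]
  simp only [simplexCone_single]
  by_cases hi : i ∈ s
  · rw [if_pos hi, map_zero, zero_add, Finset.sum_eq_single i]
    · rw [if_neg (by simp), Finset.insert_erase hi, faceSign_of_forall_le h, mul_one]
    · intro x hx hxi
      rw [if_pos (by simp [hi, hxi.symm])]
    · exact fun h' => absurd hi h'
  · rw [if_neg hi, simplexBoundary_single, Finset.sum_insert hi, Finset.erase_insert hi,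
      faceSign_of_forall_le (by simpa using h), mul_one, add_assoc, ← Finset.sum_add_distrib,
      Finset.sum_eq_zero, add_zero]
    intro x hx
    have hxi : i ≠ x := fun h => hi (h ▸ hx)
    have hlt : i < x := lt_of_le_of_ne (h x hx) hxi
    rw [if_neg (by simp [hi]), Finset.erase_insert_of_ne hxi, ← Finsupp.single_add,
      faceSign, faceSign, Finset.filter_insert, if_pos hlt,
      Finset.card_insert_of_notMem (by simp [hi])]
    rw [pow_succ]
    simp

theorem simplexBoundary_cone {i : Fin r} {c : Finset (Fin r) →₀ K}
    (hc : c ∈ Finsupp.supported K K {s | ∀ x ∈ s, i ≤ x}) :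
    simplexBoundary K r (simplexCone K i c) + simplexCone K i (simplexBoundary K r c) = c :=
  eq_of_mem_supported (φ := simplexBoundary K r ∘ₗ simplexCone K i +
    simplexCone K i ∘ₗ simplexBoundary K r) (ψ := LinearMap.id)
    (fun _ hs => simplexBoundary_cone_single hs) hc

/-- Add vertices from the largest to the smallest. If `i` precedes `s`, then `[i, s]` is the cone
over `[s]`, and the cone formula for `[s]` and for its boundary gives `∂∂[i, s] = ∂[s] - ∂[s] = 0`.
-/
theorem simplexBoundary_comp_self (c : Finset (Fin r) →₀ K) :
    simplexBoundary K r (simplexBoundary K r c) = 0 := by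
  refine LinearMap.congr_fun (f := simplexBoundary K r ∘ₗ simplexBoundary K r) (g := 0)
    (Finsupp.lhom_ext' fun s => ?_) c
  ext1
  rw [LinearMap.comp_apply, LinearMap.comp_apply, Finsupp.lsingle_apply]
  simp only [LinearMap.zero_comp, LinearMap.zero_apply]
  induction s using Finset.induction_on_min with
  | empty => simp [simplexBoundary_single]
  | insert i s his ih =>
    have hi : i ∉ s := fun h => lt_irrefl _ (his i h)
    have h1 := simplexBoundary_cone_single (K := K) (i := i) (s := s) fun x hx => (his x hx).le
    rw [simplexCone_single, if_neg hi] at h1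
    have h2 : simplexBoundary K r (Finsupp.single s 1) ∈
        Finsupp.supported K K {s : Finset (Fin r) | ∀ x ∈ s, i ≤ x} := by
      rw [simplexBoundary_single]
      refine Submodule.sum_mem _ fun y hy => Finsupp.single_mem_supported _ _ ?_
      exact fun x hx => (his x (Finset.mem_of_mem_erase hx)).le
    have h3 := simplexBoundary_cone h2
    rw [ih, map_zero, add_zero] at h3
    rw [eq_sub_of_add_eq h1, map_sub, h3, sub_self]

end Simplex

/-! ### The Taylor complex is a resolution -/

section Taylor

open BasedComplex

variable {K X : Type*} [Field K] {r : ℕ} (l : Fin r → X →₀ ℕ)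

theorem taylor_d_single (s : Finset (Fin r)) (p : MvPolynomial X K) :
    (taylor K l).d (Finsupp.single s p) = ∑ i ∈ s, Finsupp.single (s.erase i)
      (p * monomial (s.sup l - (s.erase i).sup l) (faceSign K s i)) := by
  simp [taylor, faceSign, Finset.smul_sum]

/-- The homogeneous element of multidegree `a` of the Taylor complex with scalar coefficients
`c`. -/
noncomputable def taylorStrand (K : Type*) [Field K] (a : X →₀ ℕ) :
    (Finset (Fin r) →₀ K) →+ (Finset (Fin r) →₀ MvPolynomial X K) :=
  Finsupp.liftAddHom fun s => (Finsupp.singleAddHom s).comp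
    (monomial (a - s.sup l) : K →ₗ[K] MvPolynomial X K).toAddMonoidHom

variable {l}

theorem taylorStrand_single (a : X →₀ ℕ) (s : Finset (Fin r)) (c : K) :
    taylorStrand l K a (Finsupp.single s c) = Finsupp.single s (monomial (a - s.sup l) c) := by
  simp [taylorStrand]

theorem taylorStrand_apply (a : X →₀ ℕ) (c : Finset (Fin r) →₀ K) (s : Finset (Fin r)) :
    taylorStrand l K a c s = monomial (a - s.sup l) (c s) := by
  classical
  induction c using Finsupp.induction_linear with
  | zero => simp
  | add x y hx hy => simp [hx, hy]
  | single t c =>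
    rw [taylorStrand_single]
    by_cases h : t = s
    · subst h; simp
    · simp [h]

/-- In a fixed multidegree the monomial coefficients are forced and telescope, leaving the scalar
boundary of the simplex. -/
theorem taylor_d_taylorStrand {a : X →₀ ℕ} {c : Finset (Fin r) →₀ K}
    (hc : ∀ s, c s ≠ 0 → s.sup l ≤ a) :
    (taylor K l).d (taylorStrand l K a c) = taylorStrand l K a (simplexBoundary K r c) := by
  rw [← Finsupp.sum_single c, Finsupp.sum]
  simp only [map_sum]
  refine Finset.sum_congr rfl fun s hs => ?_
  have hsa := hc s (by simpa using hs)
  rw [taylorStrand_single, taylor_d_single, simplexBoundary_single, map_sum]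
  refine Finset.sum_congr rfl fun i _ => ?_
  rw [taylorStrand_single, monomial_mul,
    tsub_add_tsub_cancel hsa (Finset.sup_mono (Finset.erase_subset i s))]

theorem taylor_d_comp_d : (taylor K l).d ∘ₗ (taylor K l).d = 0 := by
  refine Finsupp.lhom_ext' fun s => ?_
  ext1
  have h1 : (Finsupp.single s 1 : Finset (Fin r) →₀ MvPolynomial X K) =
      taylorStrand l K (s.sup l) (Finsupp.single s 1) := by
    rw [taylorStrand_single]; simp
  have h2 : ∀ t, (Finsupp.single s (1 : K)) t ≠ 0 → t.sup l ≤ s.sup l := by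
    intro t ht
    by_cases h : s = t
    · rw [h]
    · exact absurd (Finsupp.single_eq_of_ne' h) ht
  have h3 : ∀ t, simplexBoundary K r (Finsupp.single s 1) t ≠ 0 → t.sup l ≤ s.sup l := by
    have : simplexBoundary K r (Finsupp.single s 1) ∈
        Finsupp.supported K K {t : Finset (Fin r) | t.sup l ≤ s.sup l} := by
      rw [simplexBoundary_single]
      exact Submodule.sum_mem _ fun i _ => Finsupp.single_mem_supported K _
        (show (s.erase i).sup l ≤ s.sup l from Finset.sup_mono (Finset.erase_subset i s))
    exact fun t ht => this (by simpa using ht)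
  simp only [LinearMap.comp_apply, Finsupp.lsingle_apply, LinearMap.zero_apply]
  rw [h1, taylor_d_taylorStrand h2, taylor_d_taylorStrand h3, simplexBoundary_comp_self, map_zero]

theorem taylor_isComplex : (taylor K l).IsComplex where
  finite j := Set.toFinite _
  d_zero s hs := by
    have : s = ∅ := Finset.card_eq_zero.1 hs
    simp [this, taylor_d_single]
  d_homogeneous s j hs := by
    rw [taylor_d_single]
    refine isHomogeneous_sum _ _ fun i hi => ?_
    rw [one_mul]
    refine isHomogeneous_single (C := taylor K l) ?_ (Finset.sup_mono (Finset.erase_subset i s)) _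
    have : s.card = j + 1 := hs
    change (s.erase i).card = j
    rw [Finset.card_erase_of_mem hi]
    omega
  d_comp_d := taylor_d_comp_d

/-- The faces with lcm dividing `a` are all the subsets of the vertices `i` with `l i ≤ a`. They
form a full simplex, so a cycle is the boundary of its cone. -/
theorem taylor_exists_d_eq {j : ℕ} {a : X →₀ ℕ} {z : Finset (Fin r) →₀ MvPolynomial X K}
    (hz : (taylor K l).IsHomogeneous (j + 1) a z) (hd : (taylor K l).d z = 0) :
    z ∈ ((taylor K l).chains (j + 2)).map (taylor K l).d := by
  classical
  by_cases hz0 : z = 0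
  · subst hz0
    exact Submodule.zero_mem _
  obtain ⟨s₀, hs₀⟩ := Finsupp.ne_iff.1 hz0
  obtain ⟨hs1, hs2, -⟩ := hz s₀ hs₀
  have hne : (Finset.univ.filter fun i => l i ≤ a).Nonempty := by
    obtain ⟨i, hi⟩ := Finset.card_pos.1 (show 0 < s₀.card by
      have : s₀.card = j + 1 := hs1
      omega)
    exact ⟨i, by simpa using (Finset.le_sup hi).trans hs2⟩
  -- The smallest vertex is taken as apex because the cone formula requires it to precede every
  -- vertex of the faces.
  obtain ⟨i, hi, hmin⟩ := (Finset.univ.filter fun i => l i ≤ a).exists_minimal hne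
  replace hi : l i ≤ a := by simpa using hi
  replace hmin : ∀ x, l x ≤ a → i ≤ x := fun x hx =>
    (le_total i x).elim id fun h => hmin (by simpa using hx) h
  let c : Finset (Fin r) →₀ K := Finsupp.onFinset z.support
    (fun s => coeff (a - s.sup l) (z s)) fun s hs => by
      rw [Finsupp.mem_support_iff]
      rintro h
      simp [h] at hs
  have hcz : taylorStrand l K a c = z := by
    ext1 s
    rw [taylorStrand_apply]
    by_cases h : z s = 0
    · simp [c, h]
    · obtain ⟨-, -, k, hk⟩ := hz s h
      replace hk : z s = monomial (a - s.sup l) k := hk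
      simp [c, hk]
  have hc : ∀ s, c s ≠ 0 → s.card = j + 1 ∧ s.sup l ≤ a := by
    intro s hs
    have : z s ≠ 0 := fun h => hs (by simp [c, h])
    exact ⟨(hz s this).1, (hz s this).2.1⟩
  have hcS : c ∈ Finsupp.supported K K {s | s.card = j + 1 ∧ s.sup l ≤ a} :=
    fun s hs => hc s (by simpa using hs)
  have hcone : simplexCone K i c ∈ Finsupp.supported K K {s | s.card = j + 2 ∧ s.sup l ≤ a} := by
    refine map_mem_of_mem_supported (fun s hs => ?_) hcS
    rw [simplexCone_single]
    split_ifs with his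
    · exact Submodule.zero_mem _
    · refine Finsupp.single_mem_supported _ _ ⟨?_, ?_⟩
      · rw [Finset.card_insert_of_notMem his, hs.1]
      · rw [Finset.sup_insert]
        exact sup_le hi hs.2
  have hbd : simplexBoundary K r c = 0 := by
    rw [← hcz, taylor_d_taylorStrand fun s hs => (hc s hs).2] at hd
    ext1 s
    have := DFunLike.congr_fun hd s
    rw [taylorStrand_apply] at this
    simpa using this
  refine ⟨taylorStrand l K a (simplexCone K i c), ?_, ?_⟩
  · intro s hs
    refine (hcone (?_ : s ∈ _)).1
    rw [Finset.mem_coe, Finsupp.mem_support_iff] at hs ⊢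
    rw [taylorStrand_apply] at hs
    exact fun h => hs (by rw [h, map_zero])
  · rw [taylor_d_taylorStrand fun s hs => (hcone (Finsupp.mem_support_iff.2 hs)).2]
    have h := simplexBoundary_cone (K := K) (i := i) (c := c)
      fun s hs x hx => hmin x ((Finset.le_sup hx).trans (hc s (by simpa using hs)).2)
    rw [hbd, map_zero, add_zero] at h
    rw [h, hcz]

/-- The augmentation of the Taylor complex. -/
noncomputable def taylorAugmentation (r : ℕ) (M : Ideal (MvPolynomial X K)) :
    (Finset (Fin r) →₀ MvPolynomial X K) →ₗ[MvPolynomial X K] (MvPolynomial X K ⧸ M) :=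
  M.mkQ ∘ₗ Finsupp.lapply ∅

theorem taylor_isResolutionWith :
    (taylor K l).IsResolutionWith (Ideal.span (Set.range fun i => monomial (l i) (1 : K)))
      (taylorAugmentation r _) := by
  set M := Ideal.span (Set.range fun i => monomial (l i) (1 : K)) with hMdef
  have hd1 : ∀ i, (taylor K l).d (Finsupp.single {i} 1) = Finsupp.single ∅ (monomial (l i) 1) := by
    intro i
    rw [taylor_d_single, Finset.sum_singleton, faceSign_of_forall_le (by simp)]
    simp [bot_eq_zero]
  have hch : ∀ x ∈ (taylor K l).chains 0, x = Finsupp.single ∅ (x ∅) := by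
    intro x hx
    ext1 s
    by_cases h : s = ∅
    · subst h; simp
    · rw [Finsupp.single_eq_of_ne h]
      by_contra hxs
      exact h (Finset.card_eq_zero.1 (hx (by simpa using hxs)))
  have hch0 : ∀ p, Finsupp.single ∅ p ∈ (taylor K l).chains 0 := fun p =>
    Finsupp.single_mem_supported _ _
      (show (∅ : Finset (Fin r)).card = 0 from Finset.card_empty)
  refine ⟨taylor_isComplex, ?_, ?_, ?_, ?_⟩
  · intro s hs
    obtain rfl : s = ∅ := Finset.card_eq_zero.1 hs
    refine ⟨1, ?_⟩
    simp [taylorAugmentation, taylor, bot_eq_zero]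
  · rw [eq_top_iff]
    intro t _
    obtain ⟨p, rfl⟩ := M.mkQ_surjective t
    exact ⟨Finsupp.single ∅ p, hch0 p, by simp [taylorAugmentation]⟩
  · apply le_antisymm
    · rintro x ⟨hx, hx0⟩
      have hxM : x ∅ ∈ M := by
        simpa [taylorAugmentation, Ideal.Quotient.eq_zero_iff_mem] using hx
      rw [hch x hx0]
      have : M ≤ (((taylor K l).chains 1).map (taylor K l).d).comap (Finsupp.lsingle ∅) := by
        rw [hMdef, Ideal.span, Submodule.span_le]
        rintro _ ⟨i, rfl⟩
        refine ⟨Finsupp.single {i} 1, ?_, hd1 i⟩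
        exact Finsupp.single_mem_supported _ _ (Finset.card_singleton i)
      exact this hxM
    · rintro _ ⟨x, hx, rfl⟩
      refine ⟨?_, taylor_isComplex.d_mem_chains hx⟩
      refine eq_of_mem_chains (C := taylor K l) (j := 1)
        (φ := taylorAugmentation r M ∘ₗ (taylor K l).d) (ψ := 0) (fun s hs => ?_) hx
      obtain ⟨i, rfl⟩ := Finset.card_eq_one.1 hs
      rw [LinearMap.comp_apply, hd1]
      simp only [taylorAugmentation, LinearMap.comp_apply, Finsupp.lapply_apply,
        Finsupp.single_eq_same, LinearMap.zero_apply, Submodule.mkQ_apply,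
        Submodule.Quotient.mk_eq_zero]
      exact Ideal.subset_span ⟨i, rfl⟩
  · intro j
    apply le_antisymm
    · rintro z ⟨hz, hzj⟩
      obtain ⟨A, hA⟩ := exists_eq_sum_component hzj
      rw [hA]
      refine Submodule.sum_mem _ fun a _ => taylor_exists_d_eq (isHomogeneous_component z) ?_
      rw [map_component (fun b hb => taylor_isComplex.d_homogeneous b j hb) hzj,
        LinearMap.mem_ker.1 hz, map_zero]
    · rintro _ ⟨x, hx, rfl⟩
      exact ⟨taylor_isComplex.d_d x, taylor_isComplex.d_mem_chains hx⟩

/-- Divisibility of monomials is well founded, so every monomial of `M` is a multiple of a minimal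
one. -/
theorem eq_span_range_of_range_eq_minimalGenerators {M : Ideal (MvPolynomial X K)}
    (hM : IsMonomialIdeal M) (hlM : Set.range l = minimalGenerators M) :
    M = Ideal.span (Set.range fun i => monomial (l i) (1 : K)) := by
  apply le_antisymm
  · obtain ⟨E, hE⟩ := hM
    rw [hE, Ideal.span_le]
    rintro _ ⟨a, ha, rfl⟩
    have haM : monomial a (1 : K) ∈ M := hE ▸ Ideal.subset_span ⟨a, ha, rfl⟩
    obtain ⟨b, hba, hb⟩ := exists_minimal_le_of_wellFoundedLT
      (fun b => monomial b (1 : K) ∈ M) a haM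
    obtain ⟨i, rfl⟩ : b ∈ Set.range l := hlM ▸ hb
    have := Ideal.mul_mem_left (Ideal.span (Set.range fun i => monomial (l i) (1 : K)))
      (monomial (a - l i) 1) (Ideal.subset_span ⟨i, rfl⟩)
    rwa [monomial_mul, tsub_add_cancel_of_le hba, one_mul] at this
  · rw [Ideal.span_le]
    rintro _ ⟨i, rfl⟩
    have : l i ∈ minimalGenerators M := hlM ▸ ⟨i, rfl⟩
    exact Minimal.prop (P := fun b => monomial b (1 : K) ∈ M) this

end Taylor

/-! ### Multidegrees of the Taylor complex of a semidominant ideal -/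

section Semidominant

open BasedComplex

variable {K X : Type*} [Field K] {r : ℕ} {l : Fin r → X →₀ ℕ} {k : Fin r}

theorem mem_of_sup_eq_of_isDominantMonomial (hl : Function.Injective l) {s t : Finset (Fin r)}
    (h : s.sup l = t.sup l) {i : Fin r} (hi : IsDominantMonomial (Set.range l) (l i))
    (his : i ∈ s) : i ∈ t := by
  classical
  by_contra hit
  obtain ⟨x, e, he, hex, hlt⟩ := hi
  have h1 : e ≤ t.sup l x := hex.trans (h ▸ Finset.le_sup (f := l) his x)
  refine h1.not_gt ?_
  clear h1 h
  induction t using Finset.induction_on with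
  -- Positivity of the exponent is what excludes the empty set, whose lcm is `1`.
  | empty => simpa [bot_eq_zero] using he
  | insert j t hj ih =>
    rw [Finset.mem_insert, not_or] at hit
    rw [Finset.sup_insert, Finsupp.sup_apply]
    exact max_lt (not_le.1 (hlt (l j) ⟨j, rfl⟩ fun h => hit.1 (hl h).symm)) (ih hit.2)

theorem erase_eq_erase_of_sup_eq (hl : Function.Injective l)
    (hdom : ∀ i, i ≠ k → IsDominantMonomial (Set.range l) (l i))
    {s t : Finset (Fin r)} (h : s.sup l = t.sup l) :
    s.erase k = t.erase k := by
  ext i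
  simp only [Finset.mem_erase]
  exact and_congr_right fun hik => ⟨mem_of_sup_eq_of_isDominantMonomial hl h (hdom i hik),
    mem_of_sup_eq_of_isDominantMonomial hl h.symm (hdom i hik)⟩

/-- The two sets agree away from `k`, so being distinct they differ exactly by `k`; and `l k`
divides the common lcm. -/
theorem mem_cancellationPairs_of_sup_eq (hl : Function.Injective l)
    (hdom : ∀ i, i ≠ k → IsDominantMonomial (Set.range l) (l i))
    {s t : Finset (Fin r)} (h : s.sup l = t.sup l)
    (hst : s ≠ t) : (s, t) ∈ cancellationPairs l k ∨ (t, s) ∈ cancellationPairs l k := by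
  have he := erase_eq_erase_of_sup_eq hl hdom h
  by_cases hs : k ∈ s <;> by_cases ht : k ∈ t
  · exact absurd (by rw [← Finset.insert_erase hs, he, Finset.insert_erase ht]) hst
  · refine Or.inl ⟨ht, h ▸ Finset.le_sup hs, ?_⟩
    rw [← Finset.erase_eq_of_notMem ht, ← he, Finset.insert_erase hs]
  · refine Or.inr ⟨hs, h ▸ Finset.le_sup ht, ?_⟩
    rw [← Finset.erase_eq_of_notMem hs, he, Finset.insert_erase ht]
  · rw [Finset.erase_eq_of_notMem hs, Finset.erase_eq_of_notMem ht] at he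
    exact absurd he hst

theorem sup_eq_of_mem_cancellationPairs {p : Finset (Fin r) × Finset (Fin r)}
    (hp : p ∈ cancellationPairs l k) : p.1.sup l = p.2.sup l := by
  rw [hp.2.2, Finset.sup_insert, sup_eq_right]
  exact hp.2.1

theorem card_eq_of_mem_cancellationPairs {p : Finset (Fin r) × Finset (Fin r)}
    (hp : p ∈ cancellationPairs l k) : p.1.card = p.2.card + 1 := by
  rw [hp.2.2, Finset.card_insert_of_notMem hp.1]

/-- A constant term forces equal multidegrees, and the drop in homological degree fixes the
orientation of the pair. -/
theorem mem_cancellationPairs_of_constantCoeff_ne_zero (hl : Function.Injective l)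
    (hdom : ∀ i, i ≠ k → IsDominantMonomial (Set.range l) (l i)) {s t : Finset (Fin r)}
    (h : constantCoeff ((taylor K l).d (Finsupp.single s 1) t) ≠ 0) :
    (s, t) ∈ cancellationPairs l k := by
  obtain ⟨h1, h2⟩ := taylor_isComplex.of_constantCoeff_ne_zero h
  have h1 : s.card = t.card + 1 := h1
  refine (mem_cancellationPairs_of_sup_eq hl hdom h2 fun hst => by simp [hst] at h1).resolve_right
    fun hts => ?_
  have := card_eq_of_mem_cancellationPairs hts
  simp only at this
  omega

theorem exists_taylor_d_eq_C {p : Finset (Fin r) × Finset (Fin r)}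
    (hp : p ∈ cancellationPairs l k) :
    ∃ c : K, c ≠ 0 ∧ (taylor K l).d (Finsupp.single p.1 1) p.2 = MvPolynomial.C c := by
  have hsup := sup_eq_of_mem_cancellationPairs hp
  obtain ⟨s, t⟩ := p
  obtain ⟨hk, -, hs⟩ := hp
  simp only at hk hs
  subst hs
  refine ⟨faceSign K (insert k t) k, pow_ne_zero _ (by simp), ?_⟩
  simp only at hsup ⊢
  rw [taylor_d_single, Finsupp.finsetSum_apply, Finset.sum_eq_single k]
  · rw [Finset.erase_insert hk, Finsupp.single_eq_same, hsup, tsub_self, one_mul]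
    rfl
  · intro i hi hik
    rw [Finsupp.single_eq_of_ne]
    intro h
    rw [h] at hk
    exact hk (Finset.mem_erase.2 ⟨hik.symm, Finset.mem_insert_self _ _⟩)
  · exact fun h => absurd (Finset.mem_insert_self _ _) h

end Semidominant

/-! ### The two summands of a direct sum of complexes -/

namespace BasedComplex

variable {K X B B' : Type*} [Field K]

theorem sum_d_mapDomain_inl (C : BasedComplex K X B) (C' : BasedComplex K X B')
    (x : B →₀ MvPolynomial X K) :
    (C.sum C').d (x.mapDomain Sum.inl) = (C.d x).mapDomain Sum.inl := by
  refine LinearMap.congr_fun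
    (f := (C.sum C').d ∘ₗ Finsupp.lmapDomain _ (MvPolynomial X K) Sum.inl)
    (g := Finsupp.lmapDomain _ (MvPolynomial X K) Sum.inl ∘ₗ C.d)
    (Finsupp.lhom_ext' fun b => ?_) x
  ext1
  simp [sum, Finsupp.mapDomain_single]

theorem sum_d_mapDomain_inr (C : BasedComplex K X B) (C' : BasedComplex K X B')
    (x : B' →₀ MvPolynomial X K) :
    (C.sum C').d (x.mapDomain Sum.inr) = (C'.d x).mapDomain Sum.inr := by
  refine LinearMap.congr_fun
    (f := (C.sum C').d ∘ₗ Finsupp.lmapDomain _ (MvPolynomial X K) Sum.inr)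
    (g := Finsupp.lmapDomain _ (MvPolynomial X K) Sum.inr ∘ₗ C'.d)
    (Finsupp.lhom_ext' fun b => ?_) x
  ext1
  simp [sum, Finsupp.mapDomain_single]

theorem IsHomogeneous.mapDomain_inl {C : BasedComplex K X B} {x : B →₀ MvPolynomial X K} {j : ℕ}
    {a : X →₀ ℕ} (hx : C.IsHomogeneous j a x) (C' : BasedComplex K X B') :
    (C.sum C').IsHomogeneous j a (x.mapDomain Sum.inl) :=
  hx.map (C' := C.sum C') (φ := Finsupp.lmapDomain _ (MvPolynomial X K) Sum.inl) fun b hb => by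
    simpa [sum, hb, Finsupp.mapDomain_single] using
      isHomogeneous_single_one (C := C.sum C') (Sum.inl b)

theorem IsHomogeneous.mapDomain_inr {C' : BasedComplex K X B'} {x : B' →₀ MvPolynomial X K} {j : ℕ}
    {a : X →₀ ℕ} (hx : C'.IsHomogeneous j a x) (C : BasedComplex K X B) :
    (C.sum C').IsHomogeneous j a (x.mapDomain Sum.inr) :=
  hx.map (C' := C.sum C') (φ := Finsupp.lmapDomain _ (MvPolynomial X K) Sum.inr) fun b hb => by
    simpa [sum, hb, Finsupp.mapDomain_single] using
      isHomogeneous_single_one (C := C.sum C') (Sum.inr b)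

end BasedComplex

/-! ### Splitting the trivial complexes off the Taylor complex -/

section Decomposition

open BasedComplex

variable {K X : Type*} [Field K] {r : ℕ} (l : Fin r → X →₀ ℕ) (k : Fin r)

/-- The direct sum of the trivial complexes of the pairs that are cancelled. -/
noncomputable def trivialPart (K : Type*) [Field K] :
    BasedComplex K X (Σ _ : cancellationPairs l k, Bool) :=
  directSum fun p : cancellationPairs l k => (taylor K l).trivialComplex p.1.1 p.1.2

variable {l k}

theorem trivialPart_d_single_true (p : cancellationPairs l k) (c : MvPolynomial X K) :
    (trivialPart l k K).d (Finsupp.single ⟨p, true⟩ c) = Finsupp.single ⟨p, false⟩ c := by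
  simp [trivialPart, directSum, trivialComplex, Finsupp.mapDomain_single]

theorem trivialPart_d_single_false (p : cancellationPairs l k) (c : MvPolynomial X K) :
    (trivialPart l k K).d (Finsupp.single ⟨p, false⟩ c) = 0 := by
  simp [trivialPart, directSum, trivialComplex]

theorem trivialPart_d_apply (y : (Σ _ : cancellationPairs l k, Bool) →₀ MvPolynomial X K)
    (p : cancellationPairs l k) :
    (trivialPart l k K).d y ⟨p, false⟩ = y ⟨p, true⟩ ∧ (trivialPart l k K).d y ⟨p, true⟩ = 0 := by
  classical
  induction y using Finsupp.induction_linear with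
  | zero => simp
  | add x y hx hy => simp [hx, hy]
  | single b c =>
    obtain ⟨q, _ | _⟩ := b
    · simp [trivialPart_d_single_false]
    · rw [trivialPart_d_single_true]
      by_cases h : q = p
      · subst h; simp
      · simp [h]

variable (l k) in
/-- The chain map from the Taylor complex to the trivial complexes: the coordinates of the image
of `x` at `[τ]` and `[σ]` are the coordinates of `x` and `d x` at `[τ]`. -/
noncomputable def trivialProjection (K : Type*) [Field K] :
    (Finset (Fin r) →₀ MvPolynomial X K) →ₗ[MvPolynomial X K]
      ((Σ _ : cancellationPairs l k, Bool) →₀ MvPolynomial X K) where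
  toFun x := Finsupp.equivFunOnFinite.symm
    fun b => bif b.2 then (taylor K l).d x b.1.1.2 else x b.1.1.2
  map_add' x y := by
    ext1 ⟨p, _ | _⟩ <;> simp
  map_smul' c x := by
    ext1 ⟨p, _ | _⟩ <;> simp

theorem trivialProjection_apply_false (x : Finset (Fin r) →₀ MvPolynomial X K)
    (p : cancellationPairs l k) : trivialProjection l k K x ⟨p, false⟩ = x p.1.2 := rfl

theorem trivialProjection_apply_true (x : Finset (Fin r) →₀ MvPolynomial X K)
    (p : cancellationPairs l k) :
    trivialProjection l k K x ⟨p, true⟩ = (taylor K l).d x p.1.2 := rfl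

/-- The second coordinate of `x` is the first coordinate of `d x`, and the second coordinate of `d
x` vanishes because `d ∘ d = 0`. -/
theorem trivialProjection_d (x : Finset (Fin r) →₀ MvPolynomial X K) :
    trivialProjection l k K ((taylor K l).d x) =
      (trivialPart l k K).d (trivialProjection l k K x) := by
  ext1 ⟨p, _ | _⟩
  · rw [trivialProjection_apply_false, (trivialPart_d_apply _ p).1, trivialProjection_apply_true]
  · rw [trivialProjection_apply_true, (trivialPart_d_apply _ p).2, taylor_isComplex.d_d]
    rfl

theorem isHomogeneous_trivialProjection (s : Finset (Fin r)) :
    (trivialPart l k K).IsHomogeneous ((taylor K l).hdeg s) ((taylor K l).mdeg s)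
      (trivialProjection l k K (Finsupp.single s 1)) := by
  rintro ⟨p, _ | _⟩ hp
  · exact isHomogeneous_single_one (C := taylor K l) s p.1.2 hp
  · rw [trivialProjection_apply_true] at hp ⊢
    cases hs : (taylor K l).hdeg s with
    | zero => simp [taylor_isComplex.d_zero s hs] at hp
    | succ j =>
      obtain ⟨h1, h2, c, hc⟩ := taylor_isComplex.d_homogeneous s j hs _ hp
      have hsup : (taylor K l).mdeg p.1.1 = (taylor K l).mdeg p.1.2 :=
        sup_eq_of_mem_cancellationPairs p.2
      refine ⟨(card_eq_of_mem_cancellationPairs p.2).trans (congrArg (· + 1) h1), ?_, c, ?_⟩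
      · exact hsup.trans_le h2
      · rw [hc, ← hsup]
        rfl

variable {M : Ideal (MvPolynomial X K)}

/-- The Taylor resolution is the direct sum of any minimal free resolution and the trivial
complexes of the pairs that are cancelled. -/
theorem taylor_iso_sum_trivialPart (hM : IsMonomialIdeal M) (hl : Function.Injective l)
    (hlM : Set.range l = minimalGenerators M)
    (hdom : ∀ i, i ≠ k → IsDominantMonomial (Set.range l) (l i)) {B : Type*}
    {F : BasedComplex K X B} (hF : F.IsMinimalFreeResolution M) :
    (taylor K l).Iso (F.sum (trivialPart l k K)) := by
  obtain ⟨hF, hmin⟩ := hF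
  obtain ⟨ε', hF⟩ := isFreeResolution_iff.1 hF
  have hT := taylor_isResolutionWith (K := K) (l := l)
  rw [← eq_span_range_of_range_eq_minimalGenerators hM hlM] at hT
  set T := taylor K l with hTdef
  have hdF : ∀ y, F.d y ∈ residueKer K X B := fun y =>
    span_X_smul_top_le_residueKer (hmin ⟨y, rfl⟩)
  obtain ⟨f, hf, hfd, hfε⟩ := exists_comparison hM hT hF
  obtain ⟨g, hg, hgd, hgε⟩ := exists_comparison hM hF hT
  -- The homotopy on `T` will give injectivity modulo the variables, the one on `F` surjectivity.
  obtain ⟨h, hh⟩ := exists_homotopy hT.isComplex hT (g ∘ₗ f - LinearMap.id)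
    (fun b => ((hf b).map fun c hc => by simpa [hc] using hg c).sub (isHomogeneous_single_one b))
    (fun x => by simp [hfd, hgd]) (fun x hx => by
      have hfx : f x ∈ F.chains 0 :=
        map_mem_chains (fun c hc => by simpa [hc] using (hf c).mem_chains) hx
      simp [hgε _ hfx, hfε _ hx])
  obtain ⟨h', hh'⟩ := exists_homotopy hF.isComplex hF (f ∘ₗ g - LinearMap.id)
    (fun b => ((hg b).map fun c hc => by simpa [hc] using hf c).sub (isHomogeneous_single_one b))
    (fun x => by simp [hfd, hgd]) (fun x hx => by
      have hgx : g x ∈ T.chains 0 :=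
        map_mem_chains (fun c hc => by simpa [hc] using (hg c).mem_chains) hx
      simp [hfε _ hgx, hgε _ hx])
  let inl := Finsupp.lmapDomain (MvPolynomial X K) (MvPolynomial X K)
    (Sum.inl : B → B ⊕ (Σ _ : cancellationPairs l k, Bool))
  let inr := Finsupp.lmapDomain (MvPolynomial X K) (MvPolynomial X K)
    (Sum.inr : (Σ _ : cancellationPairs l k, Bool) → B ⊕ (Σ _ : cancellationPairs l k, Bool))
  let π := trivialProjection l k K
  let φ := inl ∘ₗ f + inr ∘ₗ π
  have hφ : ∀ x, φ x = inl (f x) + inr (π x) := fun _ => rfl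
  have hφl : ∀ x b, φ x (Sum.inl b) = f x b := by
    intro x b
    rw [hφ, Finsupp.add_apply]
    simp only [inl, inr, Finsupp.lmapDomain_apply]
    rw [Finsupp.mapDomain_apply Sum.inl_injective, Finsupp.mapDomain_of_notMem_range _ _ (by simp),
      add_zero]
  have hφr : ∀ x b, φ x (Sum.inr b) = π x b := by
    intro x b
    rw [hφ, Finsupp.add_apply]
    simp only [inl, inr, Finsupp.lmapDomain_apply]
    rw [Finsupp.mapDomain_apply Sum.inr_injective, Finsupp.mapDomain_of_notMem_range _ _ (by simp),
      zero_add]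
  have hφhom : ∀ s, (F.sum (trivialPart l k K)).IsHomogeneous (T.hdeg s) (T.mdeg s)
      (φ (Finsupp.single s 1)) := fun s =>
    ((hf s).mapDomain_inl _).add ((isHomogeneous_trivialProjection s).mapDomain_inr _)
  have hφd : ∀ x, φ (T.d x) = (F.sum (trivialPart l k K)).d (φ x) := by
    intro x
    rw [hφ, hφ, map_add]
    simp only [inl, inr, π, Finsupp.lmapDomain_apply]
    rw [sum_d_mapDomain_inl, sum_d_mapDomain_inr, hfd, trivialProjection_d]
  -- the differential of the Taylor complex modulo the variables
  have hdT : ∀ x t, constantCoeff (T.d x t) ≠ 0 → ∃ p : cancellationPairs l k, p.1.2 = t := by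
    intro x t hxt
    rw [apply_eq_sum, Finsupp.finsetSum_apply, map_sum] at hxt
    obtain ⟨s, -, hs⟩ := Finset.exists_ne_zero_of_sum_ne_zero hxt
    rw [Finsupp.smul_apply, smul_eq_mul, map_mul] at hs
    exact ⟨⟨_, mem_cancellationPairs_of_constantCoeff_ne_zero hl hdom (right_ne_zero_of_mul hs)⟩, rfl⟩
  have hcoeff : ∀ p : cancellationPairs l k, ∃ c : K, c ≠ 0 ∧
      T.d (Finsupp.single p.1.1 1) - (MvPolynomial.C c : MvPolynomial X K) •
        Finsupp.single p.1.2 1 ∈ residueKer K X _ := by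
    intro p
    obtain ⟨c, hc, hcd⟩ := exists_taylor_d_eq_C (K := K) p.2
    refine ⟨c, hc, fun t => ?_⟩
    by_cases ht : t = p.1.2
    · subst ht
      rw [Finsupp.sub_apply, hcd]
      simp
    · rw [Finsupp.sub_apply, Finsupp.smul_apply, Finsupp.single_eq_of_ne ht, smul_zero, sub_zero]
      by_contra hne
      have := mem_cancellationPairs_of_constantCoeff_ne_zero hl hdom hne
      have h1 := congrArg (·.erase k) (p.2.2.2.symm.trans this.2.2)
      simp only [Finset.erase_insert p.2.1, Finset.erase_insert this.1] at h1
      exact ht h1.symm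
  have hd2 : ∀ p : cancellationPairs l k,
      T.d (Finsupp.single p.1.2 1) ∈ residueKer K X _ := by
    intro p t
    by_contra hne
    have := mem_cancellationPairs_of_constantCoeff_ne_zero hl hdom hne
    refine p.2.1 ?_
    rw [show p.1.2 = insert k t from this.2.2]
    exact Finset.mem_insert_self k t
  -- Modulo the variables `c [τ]` is the boundary `d [σ]`, and `f` carries it to a boundary of `F`,
  -- which vanishes there by minimality.
  have hf2 : ∀ p : cancellationPairs l k, f (Finsupp.single p.1.2 1) ∈ residueKer K X _ := by
    intro p
    obtain ⟨c, hc, hcd⟩ := hcoeff p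
    have h1 := Submodule.sub_mem _ (hdF (f (Finsupp.single p.1.1 1))) (map_mem_residueKer f hcd)
    rw [map_sub, hfd, sub_sub_cancel, map_smul] at h1
    intro b
    have := h1 b
    simpa [hc] using this
  have hπ2 : ∀ p : cancellationPairs l k, π (Finsupp.single p.1.2 1) - Finsupp.single ⟨p, false⟩ 1 ∈
      residueKer K X _ := by
    rintro p ⟨q, _ | _⟩
    · rw [Finsupp.sub_apply, trivialProjection_apply_false]
      by_cases hpq : p = q
      · subst hpq; simp
      · have hne : p.1.2 ≠ q.1.2 := fun h => hpq <| Subtype.ext <| Prod.ext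
          (by rw [p.2.2.2, q.2.2.2, h]) h
        rw [Finsupp.single_eq_of_ne' hne, Finsupp.single_eq_of_ne' (by simpa using hpq)]
        simp
    · rw [Finsupp.sub_apply, trivialProjection_apply_true, Finsupp.single_eq_of_ne (by simp),
        sub_zero]
      exact hd2 p q.1.2
  set R := LinearMap.range φ ⊔ residueKer K X (B ⊕ (Σ _ : cancellationPairs l k, Bool)) with hR
  have hRφ : ∀ x, φ x ∈ R := fun x => Submodule.mem_sup_left ⟨x, rfl⟩
  have hRm : ∀ y ∈ residueKer K X (B ⊕ (Σ _ : cancellationPairs l k, Bool)), y ∈ R :=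
    fun y hy => Submodule.mem_sup_right hy
  have hRfalse : ∀ p, inr (Finsupp.single ⟨p, false⟩ 1) ∈ R := by
    intro p
    have h1 := hRφ (Finsupp.single p.1.2 1)
    rw [hφ] at h1
    have h2 := hRm _ (map_mem_residueKer inl (hf2 p))
    have h3 := hRm _ (map_mem_residueKer inr (hπ2 p))
    rw [map_sub] at h3
    have := Submodule.sub_mem _ (Submodule.sub_mem _ h1 h2) h3
    simpa using this
  have hRinr : ∀ y : (Σ _ : cancellationPairs l k, Bool) →₀ MvPolynomial X K,
      (∀ p, constantCoeff (y ⟨p, true⟩) = 0) → inr y ∈ R := by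
    intro y hy
    rw [← Finsupp.sum_single y, Finsupp.sum, map_sum]
    refine Submodule.sum_mem _ ?_
    rintro ⟨p, _ | _⟩ -
    · have := Submodule.smul_mem _ (y ⟨p, false⟩) (hRfalse p)
      rw [← map_smul] at this
      simpa using this
    · have := hRm _ (map_mem_residueKer inr
        (smul_mem_residueKer (hy p) (Finsupp.single ⟨p, true⟩ 1)))
      simpa using this
  -- Use `φ (g y)`: modulo the variables `f (g y)` is `y`, and the `true` coordinates of `π (g y)`
  -- come from `d (g y) = g (d y)` and vanish, so `hRinr` absorbs the rest.
  have hRinl : ∀ y, inl y ∈ R := by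
    intro y
    have h1 := hRφ (g y)
    rw [hφ] at h1
    have h2 := hRinr (π (g y)) fun p => by
      rw [trivialProjection_apply_true, ← hTdef, ← hgd]
      exact map_mem_residueKer g (hdF y) _
    have h3 : f (g y) - y ∈ residueKer K X B := by
      have := hh' y
      rw [LinearMap.sub_apply, LinearMap.comp_apply, LinearMap.id_apply] at this
      rw [← this]
      exact Submodule.add_mem _ (hdF _) (map_mem_residueKer h' (hdF y))
    have h4 := hRm _ (map_mem_residueKer inl h3)
    rw [map_sub] at h4
    have := Submodule.sub_mem _ (Submodule.sub_mem _ h1 h2) h4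
    simpa using this
  -- `φ [σ]` has `true` part `c` times this basis element modulo the variables; its other parts
  -- already lie in `R`, and `c` is invertible.
  have hRtrue : ∀ p, inr (Finsupp.single ⟨p, true⟩ 1) ∈ R := by
    intro p
    obtain ⟨c, hc, hcd⟩ := hcoeff p
    have h1 := hRφ (Finsupp.single p.1.1 1)
    rw [hφ] at h1
    have h2 := hRinr (π (Finsupp.single p.1.1 1) -
        (MvPolynomial.C c : MvPolynomial X K) • Finsupp.single ⟨p, true⟩ 1) fun q => by
      rw [Finsupp.sub_apply, trivialProjection_apply_true]
      by_cases hpq : p = q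
      · subst hpq
        simpa using hcd p.1.2
      · have hne : p.1.2 ≠ q.1.2 := fun h => hpq <| Subtype.ext <| Prod.ext
          (by rw [p.2.2.2, q.2.2.2, h]) h
        rw [Finsupp.smul_apply, Finsupp.single_eq_of_ne' (by simpa using hpq)]
        have := hcd q.1.2
        rw [Finsupp.sub_apply, Finsupp.smul_apply, Finsupp.single_eq_of_ne' hne] at this
        exact this
    rw [map_sub, map_smul] at h2
    have h3 := Submodule.sub_mem _ (Submodule.sub_mem _ h1 (hRinl (f (Finsupp.single p.1.1 1)))) h2
    have h4 := Submodule.smul_mem _ (MvPolynomial.C c⁻¹ : MvPolynomial X K) h3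
    rw [add_sub_cancel_left, sub_sub_cancel, smul_smul, ← C_mul, inv_mul_cancel₀ hc, C_1,
      one_smul] at h4
    exact h4
  have hbij : Function.Bijective φ := by
    refine bijective_of_residue hφhom ?_ ?_
    · rintro (b | ⟨p, _ | _⟩)
      · simpa [inl, Finsupp.mapDomain_single] using hRinl (Finsupp.single b 1)
      · simpa [inr, Finsupp.mapDomain_single] using hRfalse p
      · simpa [inr, Finsupp.mapDomain_single] using hRtrue p
    -- If `f x` and `π x` vanish modulo the variables, so does `d x`, whose constant terms only
    -- occur at some `[τ]`. The homotopy then gives `-x ≡ d (h x)`, so `x` too has constant terms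
    -- only at some `[τ]`, where `π x` excludes them.
    · intro x hx
      have hfx : f x ∈ residueKer K X B := fun b => by rw [← hφl]; exact hx _
      have hdx : T.d x ∈ residueKer K X _ := by
        intro t
        by_contra hne
        obtain ⟨p, rfl⟩ := hdT x t hne
        have := hx (Sum.inr ⟨p, true⟩)
        rw [hφr, trivialProjection_apply_true] at this
        exact hne this
      intro t
      by_contra hne
      have h1 := DFunLike.congr_fun (hh x) t
      rw [LinearMap.sub_apply, LinearMap.comp_apply, LinearMap.id_apply, Finsupp.add_apply,
        Finsupp.sub_apply] at h1
      have h2 := congrArg constantCoeff h1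
      rw [map_add, map_sub, map_mem_residueKer h hdx t, map_mem_residueKer g hfx t, add_zero,
        zero_sub] at h2
      obtain ⟨p, rfl⟩ := hdT (h x) t (by rw [h2]; exact neg_ne_zero.2 hne)
      have := hx (Sum.inr ⟨p, false⟩)
      rw [hφr, trivialProjection_apply_false] at this
      exact hne this
  exact ⟨LinearEquiv.ofBijective φ hbij, hφhom, hφd⟩

end Decomposition

namespace BasedComplex

/-! ### A single standard cancellation -/

section Cancellation

variable {K X B : Type*} [Field K]

/-- The map of homological degree one that sends `[τ]` to `c⁻¹ [σ]` and kills the other basis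
elements. -/
noncomputable def cancelHomotopy (X : Type*) (σ τ : B) (c : K) :
    (B →₀ MvPolynomial X K) →ₗ[MvPolynomial X K] (B →₀ MvPolynomial X K) :=
  (MvPolynomial.C c⁻¹ : MvPolynomial X K) • (Finsupp.lsingle σ ∘ₗ Finsupp.lapply τ)

theorem cancelHomotopy_apply (σ τ : B) (c : K) (x : B →₀ MvPolynomial X K) :
    cancelHomotopy X σ τ c x = (MvPolynomial.C c⁻¹ * x τ) • Finsupp.single σ 1 := by
  simp [cancelHomotopy]

variable (C : BasedComplex K X B) (σ τ : B) (c : K)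

/-- The inclusion of the cancelled complex. -/
noncomputable def cancelInclusion :
    (({σ, τ}ᶜ : Set B) →₀ MvPolynomial X K) →ₗ[MvPolynomial X K] (B →₀ MvPolynomial X K) :=
  (LinearMap.id - cancelHomotopy X σ τ c ∘ₗ C.d) ∘ₗ
    Finsupp.lmapDomain (MvPolynomial X K) (MvPolynomial X K) Subtype.val

/-- The retraction to the cancelled complex. -/
noncomputable def cancelRetraction :
    (B →₀ MvPolynomial X K) →ₗ[MvPolynomial X K] (({σ, τ}ᶜ : Set B) →₀ MvPolynomial X K) :=
  Finsupp.lsubtypeDomain ({σ, τ}ᶜ : Set B) ∘ₗ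
    (LinearMap.id - C.d ∘ₗ cancelHomotopy X σ τ c)

/-- The complex that results from the standard cancellation of `[σ]` and `[τ]`, where the entry
`a_{τσ}` is `c`. -/
noncomputable def cancel : BasedComplex K X ({σ, τ}ᶜ : Set B) where
  hdeg b := C.hdeg b
  mdeg b := C.mdeg b
  d := C.cancelRetraction σ τ c ∘ₗ C.d ∘ₗ C.cancelInclusion σ τ c

variable {C σ τ c}

theorem cancelInclusion_apply (y : ({σ, τ}ᶜ : Set B) →₀ MvPolynomial X K) :
    C.cancelInclusion σ τ c y =
      y.mapDomain Subtype.val - cancelHomotopy X σ τ c (C.d (y.mapDomain Subtype.val)) := rfl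

theorem cancelRetraction_apply (x : B →₀ MvPolynomial X K) (b : ({σ, τ}ᶜ : Set B)) :
    C.cancelRetraction σ τ c x b = x b - C.d (cancelHomotopy X σ τ c x) b := rfl

theorem cancel_d_apply (y : ({σ, τ}ᶜ : Set B) →₀ MvPolynomial X K) :
    (C.cancel σ τ c).d y = C.cancelRetraction σ τ c (C.d (C.cancelInclusion σ τ c y)) := rfl

theorem mapDomain_val_apply_left (y : ({σ, τ}ᶜ : Set B) →₀ MvPolynomial X K) :
    y.mapDomain Subtype.val σ = 0 :=
  Finsupp.mapDomain_of_notMem_range _ _ (by simp)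

theorem mapDomain_val_apply_right (y : ({σ, τ}ᶜ : Set B) →₀ MvPolynomial X K) :
    y.mapDomain Subtype.val τ = 0 :=
  Finsupp.mapDomain_of_notMem_range _ _ (by simp)

theorem mapDomain_val_lsubtypeDomain (hστ : σ ≠ τ) (x : B →₀ MvPolynomial X K) :
    (Finsupp.lsubtypeDomain (R := MvPolynomial X K) ({σ, τ}ᶜ : Set B) x).mapDomain Subtype.val =
      x - x σ • Finsupp.single σ 1 - x τ • Finsupp.single τ 1 := by
  classical
  ext1 b
  by_cases hb : b ∈ ({σ, τ}ᶜ : Set B)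
  · have h1 : b ≠ σ ∧ b ≠ τ := by simpa using hb
    have := Finsupp.mapDomain_apply Subtype.val_injective
      (Finsupp.lsubtypeDomain (R := MvPolynomial X K) ({σ, τ}ᶜ : Set B) x) ⟨b, hb⟩
    rw [this]
    simp [Finsupp.single_eq_of_ne h1.1, Finsupp.single_eq_of_ne h1.2]
    rfl
  · rw [Finsupp.mapDomain_of_notMem_range _ _ (by simpa using hb)]
    obtain rfl | rfl : b = σ ∨ b = τ := by
      simpa [or_iff_not_imp_left] using hb
    · simp [Finsupp.single_eq_of_ne hστ]
    · simp [Finsupp.single_eq_of_ne hστ.symm]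

/-- The hypotheses under which `[σ]` and `[τ]` can be cancelled. -/
structure IsCancellable (C : BasedComplex K X B) (σ τ : B) (c : K) : Prop where
  isComplex : C.IsComplex
  ne_zero : c ≠ 0
  entry_eq : C.entry τ σ = MvPolynomial.C c

namespace IsCancellable

theorem hdeg_eq (h : C.IsCancellable σ τ c) : C.hdeg σ = C.hdeg τ + 1 :=
  (h.isComplex.of_constantCoeff_ne_zero (by
    rw [show C.d _ _ = _ from h.entry_eq]; simpa using h.ne_zero)).1

theorem mdeg_eq (h : C.IsCancellable σ τ c) : C.mdeg σ = C.mdeg τ :=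
  (h.isComplex.of_constantCoeff_ne_zero (by
    rw [show C.d _ _ = _ from h.entry_eq]; simpa using h.ne_zero)).2

theorem ne (h : C.IsCancellable σ τ c) : σ ≠ τ := fun he => by
  have := h.hdeg_eq
  rw [he] at this
  omega

theorem C_inv_mul (h : C.IsCancellable σ τ c) :
    (MvPolynomial.C c⁻¹ : MvPolynomial X K) * MvPolynomial.C c = 1 := by
  rw [← C_mul, inv_mul_cancel₀ h.ne_zero, C_1]

theorem d_single_apply (h : C.IsCancellable σ τ c) :
    C.d (Finsupp.single σ 1) τ = MvPolynomial.C c := h.entry_eq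

theorem homotopy_d_homotopy (h : C.IsCancellable σ τ c) (x : B →₀ MvPolynomial X K) :
    cancelHomotopy X σ τ c (C.d (cancelHomotopy X σ τ c x)) = cancelHomotopy X σ τ c x := by
  rw [cancelHomotopy_apply σ τ c x, map_smul, map_smul, cancelHomotopy_apply, h.d_single_apply,
    h.C_inv_mul, one_smul]

theorem homotopy_d_inclusion (h : C.IsCancellable σ τ c)
    (y : ({σ, τ}ᶜ : Set B) →₀ MvPolynomial X K) :
    cancelHomotopy X σ τ c (C.d (C.cancelInclusion σ τ c y)) = 0 := by
  rw [cancelInclusion_apply, map_sub, map_sub, h.homotopy_d_homotopy, sub_self]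

theorem d_inclusion_apply (h : C.IsCancellable σ τ c)
    (y : ({σ, τ}ᶜ : Set B) →₀ MvPolynomial X K) : C.d (C.cancelInclusion σ τ c y) τ = 0 := by
  have := DFunLike.congr_fun (h.homotopy_d_inclusion y) σ
  rw [cancelHomotopy_apply] at this
  simpa [h.ne_zero] using this

theorem retraction_d_homotopy (h : C.IsCancellable σ τ c) (x : B →₀ MvPolynomial X K) :
    C.cancelRetraction σ τ c (C.d (cancelHomotopy X σ τ c x)) = 0 := by
  ext1 b
  rw [cancelRetraction_apply, h.homotopy_d_homotopy, sub_self]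
  rfl

theorem inclusion_apply_right (h : C.IsCancellable σ τ c)
    (y : ({σ, τ}ᶜ : Set B) →₀ MvPolynomial X K) : C.cancelInclusion σ τ c y τ = 0 := by
  rw [cancelInclusion_apply, cancelHomotopy_apply]
  simp [mapDomain_val_apply_right, Finsupp.single_eq_of_ne h.ne.symm]

theorem retraction_inclusion (h : C.IsCancellable σ τ c)
    (y : ({σ, τ}ᶜ : Set B) →₀ MvPolynomial X K) :
    C.cancelRetraction σ τ c (C.cancelInclusion σ τ c y) = y := by
  ext1 b
  have hb : (b : B) ≠ σ := fun hb => b.2 (Or.inl hb)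
  rw [cancelRetraction_apply, cancelHomotopy_apply, h.inclusion_apply_right, mul_zero, zero_smul,
    map_zero, cancelInclusion_apply, cancelHomotopy_apply]
  simp [Finsupp.single_eq_of_ne hb, Finsupp.mapDomain_apply Subtype.val_injective]

/-- With `retraction_inclusion`, this makes the cancelled complex a deformation retract; both
exactness and the inverse change of basis follow from it. -/
theorem inclusion_retraction (h : C.IsCancellable σ τ c) (x : B →₀ MvPolynomial X K) :
    C.cancelInclusion σ τ c (C.cancelRetraction σ τ c x) =
      x - C.d (cancelHomotopy X σ τ c x) - cancelHomotopy X σ τ c (C.d x) := by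
  set z := x - C.d (cancelHomotopy X σ τ c x) with hz
  have h1 : (C.cancelRetraction σ τ c x).mapDomain Subtype.val =
      z - z σ • Finsupp.single σ 1 - z τ • Finsupp.single τ 1 :=
    mapDomain_val_lsubtypeDomain h.ne z
  have h2 : z τ = 0 := by
    rw [hz, Finsupp.sub_apply, cancelHomotopy_apply, map_smul, Finsupp.smul_apply,
      h.d_single_apply, smul_eq_mul, mul_right_comm, h.C_inv_mul, one_mul, sub_self]
  -- Hence `1 - hd` kills `[σ]`, so dropping the `σ` coordinate of `z` loses nothing.
  have h3 : cancelHomotopy X σ τ c (C.d (Finsupp.single σ 1)) = Finsupp.single σ 1 := by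
    rw [cancelHomotopy_apply, h.d_single_apply, h.C_inv_mul, one_smul]
  have h4 : C.d z = C.d x := by
    rw [hz, map_sub, h.isComplex.d_d, sub_zero]
  rw [cancelInclusion_apply, h1, h2, zero_smul, sub_zero, map_sub, map_sub, map_smul, map_smul, h3,
    h4]
  abel

theorem d_inclusion (h : C.IsCancellable σ τ c) (y : ({σ, τ}ᶜ : Set B) →₀ MvPolynomial X K) :
    C.cancelInclusion σ τ c ((C.cancel σ τ c).d y) = C.d (C.cancelInclusion σ τ c y) := by
  rw [cancel_d_apply, h.inclusion_retraction, h.homotopy_d_inclusion, h.isComplex.d_d]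
  simp

theorem retraction_d (h : C.IsCancellable σ τ c) (x : B →₀ MvPolynomial X K) :
    (C.cancel σ τ c).d (C.cancelRetraction σ τ c x) = C.cancelRetraction σ τ c (C.d x) := by
  rw [cancel_d_apply, h.inclusion_retraction, map_sub, map_sub, map_sub, h.isComplex.d_d, sub_zero,
    h.retraction_d_homotopy, sub_zero]

theorem isHomogeneous_homotopy (h : C.IsCancellable σ τ c) {j : ℕ} {a : X →₀ ℕ}
    {x : B →₀ MvPolynomial X K} (hx : C.IsHomogeneous j a x) :
    C.IsHomogeneous (j + 1) a (cancelHomotopy X σ τ c x) := by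
  rw [cancelHomotopy_apply]
  by_cases hτ : x τ = 0
  · rw [hτ, mul_zero, zero_smul]
    exact isHomogeneous_zero
  · obtain ⟨h1, h2, k, hk⟩ := hx τ hτ
    rw [hk, C_mul_monomial, Finsupp.smul_single, smul_eq_mul, mul_one, ← h.mdeg_eq]
    exact isHomogeneous_single (by rw [h.hdeg_eq, h1]) (h.mdeg_eq.trans_le h2) _

theorem isHomogeneous_homotopy_d (h : C.IsCancellable σ τ c) {j : ℕ} {a : X →₀ ℕ}
    {x : B →₀ MvPolynomial X K} (hx : C.IsHomogeneous j a x) :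
    C.IsHomogeneous j a (cancelHomotopy X σ τ c (C.d x)) := by
  cases j with
  | zero =>
    rw [h.isComplex.d_eq_zero hx.mem_chains, map_zero]
    exact isHomogeneous_zero
  | succ j => exact h.isHomogeneous_homotopy (h.isComplex.isHomogeneous_d hx)

theorem isHomogeneous_inclusion (h : C.IsCancellable σ τ c) (b : ({σ, τ}ᶜ : Set B)) :
    C.IsHomogeneous ((C.cancel σ τ c).hdeg b) ((C.cancel σ τ c).mdeg b)
      (C.cancelInclusion σ τ c (Finsupp.single b 1)) := by
  rw [cancelInclusion_apply, Finsupp.mapDomain_single]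
  have := isHomogeneous_single_one (C := C) (b : B)
  exact this.sub (h.isHomogeneous_homotopy_d this)

theorem isHomogeneous_retraction (h : C.IsCancellable σ τ c) {j : ℕ} {a : X →₀ ℕ}
    {x : B →₀ MvPolynomial X K} (hx : C.IsHomogeneous j a x) :
    (C.cancel σ τ c).IsHomogeneous j a (C.cancelRetraction σ τ c x) := fun b hb =>
  (hx.sub (h.isComplex.isHomogeneous_d (h.isHomogeneous_homotopy hx))) b hb

theorem inclusion_mem_chains (h : C.IsCancellable σ τ c) {j : ℕ}
    {y : ({σ, τ}ᶜ : Set B) →₀ MvPolynomial X K} (hy : y ∈ (C.cancel σ τ c).chains j) :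
    C.cancelInclusion σ τ c y ∈ C.chains j :=
  map_mem_chains (C := C.cancel σ τ c) (fun b hb => by
    have := (h.isHomogeneous_inclusion b).mem_chains
    rwa [hb] at this) hy

theorem retraction_mem_chains (h : C.IsCancellable σ τ c) {j : ℕ}
    {x : B →₀ MvPolynomial X K} (hx : x ∈ C.chains j) :
    C.cancelRetraction σ τ c x ∈ (C.cancel σ τ c).chains j :=
  map_mem_chains (C' := C.cancel σ τ c) (fun b hb => by
    have := (h.isHomogeneous_retraction (isHomogeneous_single_one b)).mem_chains
    rwa [hb] at this) hx

theorem homotopy_mem_chains (h : C.IsCancellable σ τ c) {j : ℕ}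
    {x : B →₀ MvPolynomial X K} (hx : x ∈ C.chains j) :
    cancelHomotopy X σ τ c x ∈ C.chains (j + 1) :=
  map_mem_chains (C' := C) (fun b hb => by
    have := (h.isHomogeneous_homotopy (isHomogeneous_single_one b)).mem_chains
    rwa [hb] at this) hx

theorem isComplex_cancel (h : C.IsCancellable σ τ c) : (C.cancel σ τ c).IsComplex where
  finite j := (h.isComplex.finite j).preimage Subtype.val_injective.injOn
  d_zero b hb := by
    have := (h.isHomogeneous_inclusion b).mem_chains
    rw [hb] at this
    rw [cancel_d_apply, h.isComplex.d_eq_zero this, map_zero]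
  d_homogeneous b j hb := by
    have := h.isHomogeneous_inclusion b
    rw [hb] at this
    exact h.isHomogeneous_retraction (h.isComplex.isHomogeneous_d this)
  d_comp_d := by
    refine LinearMap.ext fun y => ?_
    rw [LinearMap.comp_apply, cancel_d_apply y, h.retraction_d, h.isComplex.d_d, map_zero]
    rfl

variable {M : Ideal (MvPolynomial X K)}
  {ε : (B →₀ MvPolynomial X K) →ₗ[MvPolynomial X K] (MvPolynomial X K ⧸ M)}

theorem isResolutionWith_cancel (h : C.IsCancellable σ τ c) (hε : C.IsResolutionWith M ε) :
    (C.cancel σ τ c).IsResolutionWith M (ε ∘ₗ C.cancelInclusion σ τ c) where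
  isComplex := h.isComplex_cancel
  homogeneous b hb := by
    have hb' : C.hdeg b = 0 := hb
    obtain ⟨k, hk⟩ := hε.homogeneous b hb'
    refine ⟨k, ?_⟩
    rw [LinearMap.comp_apply, cancelInclusion_apply, Finsupp.mapDomain_single,
      h.isComplex.d_zero b hb', map_zero, sub_zero, hk]
    rfl
  map_eq_top := by
    rw [eq_top_iff]
    intro t _
    obtain ⟨x, hx, rfl⟩ : t ∈ (C.chains 0).map ε := by rw [hε.map_eq_top]; trivial
    refine ⟨C.cancelRetraction σ τ c x, h.retraction_mem_chains hx, ?_⟩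
    rw [LinearMap.comp_apply, h.inclusion_retraction, h.isComplex.d_eq_zero hx, map_zero, sub_zero,
      map_sub, hε.augmentation_d (h.homotopy_mem_chains hx), sub_zero]
  ker_zero := by
    apply le_antisymm
    · rintro z ⟨hz, hz0⟩
      have hi : C.cancelInclusion σ τ c z ∈ (C.chains 1).map C.d := by
        rw [← hε.ker_zero]
        exact ⟨hz, h.inclusion_mem_chains hz0⟩
      obtain ⟨y, hy, hyz⟩ := hi
      exact ⟨_, h.retraction_mem_chains hy, by rw [h.retraction_d, hyz, h.retraction_inclusion]⟩
    · rintro _ ⟨w, hw, rfl⟩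
      refine ⟨?_, h.isComplex_cancel.d_mem_chains hw⟩
      rw [SetLike.mem_coe, LinearMap.mem_ker, LinearMap.comp_apply, h.d_inclusion]
      exact hε.augmentation_d (h.inclusion_mem_chains hw)
  ker_succ j := by
    apply le_antisymm
    · rintro z ⟨hz, hzj⟩
      have hi : C.cancelInclusion σ τ c z ∈ (C.chains (j + 2)).map C.d := by
        rw [← hε.ker_succ]
        refine ⟨?_, h.inclusion_mem_chains hzj⟩
        rw [SetLike.mem_coe, LinearMap.mem_ker, ← h.d_inclusion, LinearMap.mem_ker.1 hz, map_zero]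
      obtain ⟨y, hy, hyz⟩ := hi
      exact ⟨_, h.retraction_mem_chains hy, by rw [h.retraction_d, hyz, h.retraction_inclusion]⟩
    · rintro _ ⟨w, hw, rfl⟩
      exact ⟨h.isComplex_cancel.d_d w, h.isComplex_cancel.d_mem_chains hw⟩

theorem cancel_entry (h : C.IsCancellable σ τ c) (s t : ({σ, τ}ᶜ : Set B)) :
    (C.cancel σ τ c).entry t s =
      C.entry t s - MvPolynomial.C c⁻¹ * C.entry τ s * C.entry t σ := by
  rw [entry, cancel_d_apply, cancelRetraction_apply, h.homotopy_d_inclusion, map_zero,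
    cancelInclusion_apply, Finsupp.mapDomain_single, cancelHomotopy_apply, map_sub, map_smul]
  simp only [entry, Finsupp.zero_apply, sub_zero, Finsupp.sub_apply, Finsupp.smul_apply,
    smul_eq_mul]

/-- The standard change of basis, as a linear equivalence. -/
noncomputable def changeEquiv (h : C.IsCancellable σ τ c) :
    (B →₀ MvPolynomial X K) ≃ₗ[MvPolynomial X K] (B →₀ MvPolynomial X K) :=
  LinearEquiv.ofLinearMap
    (C.cancelInclusion σ τ c ∘ₗ Finsupp.lsubtypeDomain ({σ, τ}ᶜ : Set B) +
      (Finsupp.lapply σ).smulRight (Finsupp.single σ 1) +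
      (Finsupp.lapply τ).smulRight (C.d (Finsupp.single σ 1)))
    -- The new coordinates of `y`: the retraction at the surviving elements, `c⁻¹ y_τ` at `[τ]' = d
    -- [σ]`, and `c⁻¹ (d y)_τ` at `[σ]`. That they recombine to `y` is `inclusion_retraction`.
    (Finsupp.lmapDomain (MvPolynomial X K) (MvPolynomial X K) Subtype.val ∘ₗ
        C.cancelRetraction σ τ c +
      (MvPolynomial.C c⁻¹ : MvPolynomial X K) •
        (Finsupp.lapply τ).smulRight (Finsupp.single τ 1) +
      cancelHomotopy X σ τ c ∘ₗ C.d)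
    (by
      refine LinearMap.ext fun y => ?_
      have h1 : Finsupp.lsubtypeDomain (R := MvPolynomial X K) ({σ, τ}ᶜ : Set B)
          ((C.cancelRetraction σ τ c y).mapDomain Subtype.val) = C.cancelRetraction σ τ c y := by
        ext1 b
        exact Finsupp.mapDomain_apply Subtype.val_injective _ b
      have h2 : Finsupp.lsubtypeDomain (R := MvPolynomial X K) ({σ, τ}ᶜ : Set B)
          (Finsupp.single τ (1 : MvPolynomial X K)) = 0 := by
        ext1 b
        exact Finsupp.single_eq_of_ne fun hb => b.2 (Or.inr hb)
      have h3 : Finsupp.lsubtypeDomain (R := MvPolynomial X K) ({σ, τ}ᶜ : Set B)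
          (Finsupp.single σ (1 : MvPolynomial X K)) = 0 := by
        ext1 b
        exact Finsupp.single_eq_of_ne fun hb => b.2 (Or.inl hb)
      have h4 := h.inclusion_retraction y
      rw [cancelHomotopy_apply, cancelHomotopy_apply, map_smul] at h4
      simp only [LinearMap.comp_apply, LinearMap.add_apply, LinearMap.smul_apply,
        LinearMap.smulRight_apply, Finsupp.lapply_apply, Finsupp.lmapDomain_apply,
        cancelHomotopy_apply, map_add, map_smul, h1, h2, h3, h4, mapDomain_val_apply_left,
        mapDomain_val_apply_right, Finsupp.single_eq_same, Finsupp.single_eq_of_ne h.ne,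
        Finsupp.single_eq_of_ne h.ne.symm,
        add_zero, zero_add, LinearMap.id_apply, zero_smul, one_smul, map_zero, smul_smul]
      abel)
    (by
      refine LinearMap.ext fun x => ?_
      have h1 : C.cancelRetraction σ τ c (Finsupp.single σ 1) = 0 := by
        ext1 b
        have hb : (b : B) ≠ σ := fun hb => b.2 (Or.inl hb)
        rw [cancelRetraction_apply, cancelHomotopy_apply, Finsupp.single_eq_of_ne h.ne.symm,
          Finsupp.single_eq_of_ne hb]
        simp
      have h2 : C.cancelRetraction σ τ c (C.d (Finsupp.single σ 1)) = 0 := by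
        ext1 b
        rw [cancelRetraction_apply, cancelHomotopy_apply, h.d_single_apply, h.C_inv_mul, one_smul,
          sub_self]
        rfl
      have h3 := mapDomain_val_lsubtypeDomain h.ne x
      simp only [LinearMap.comp_apply, LinearMap.add_apply, LinearMap.smul_apply,
        LinearMap.smulRight_apply, Finsupp.lapply_apply, Finsupp.lmapDomain_apply,
        cancelHomotopy_apply, map_add, map_smul, h1, h2, h3, h.retraction_inclusion,
        h.inclusion_apply_right, h.d_inclusion_apply, h.isComplex.d_d, h.d_single_apply,
        Finsupp.single_eq_of_ne h.ne.symm, smul_zero,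
        add_zero, zero_add, LinearMap.id_apply, mul_zero, Finsupp.zero_apply, zero_smul,
        Finsupp.mapDomain_zero, h.C_inv_mul, one_smul]
      rw [smul_smul (MvPolynomial.C c⁻¹ : MvPolynomial X K), h.C_inv_mul, one_smul]
      abel)

theorem changeEquiv_apply (h : C.IsCancellable σ τ c) (x : B →₀ MvPolynomial X K) :
    h.changeEquiv x =
      C.cancelInclusion σ τ c
        (Finsupp.lsubtypeDomain (R := MvPolynomial X K) ({σ, τ}ᶜ : Set B) x) +
      x σ • Finsupp.single σ 1 + x τ • C.d (Finsupp.single σ 1) := rfl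

theorem changeEquiv_symm_apply (h : C.IsCancellable σ τ c) (y : B →₀ MvPolynomial X K)
    (b : ({σ, τ}ᶜ : Set B)) : h.changeEquiv.symm y b = C.cancelRetraction σ τ c y b := by
  have h1 : (b : B) ≠ σ := fun hb => b.2 (Or.inl hb)
  have h2 : (b : B) ≠ τ := fun hb => b.2 (Or.inr hb)
  change ((C.cancelRetraction σ τ c y).mapDomain Subtype.val +
    (MvPolynomial.C c⁻¹ : MvPolynomial X K) • (y τ • Finsupp.single τ 1) +
      cancelHomotopy X σ τ c (C.d y) : B →₀ MvPolynomial X K) b = _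
  rw [cancelHomotopy_apply]
  simp [Finsupp.mapDomain_apply Subtype.val_injective, Finsupp.single_eq_of_ne h1,
    Finsupp.single_eq_of_ne h2]

theorem changeEquiv_single_val (h : C.IsCancellable σ τ c) (b : ({σ, τ}ᶜ : Set B)) :
    h.changeEquiv (Finsupp.single b 1) = C.cancelInclusion σ τ c (Finsupp.single b 1) := by
  have h1 : (b : B) ≠ σ := fun hb => b.2 (Or.inl hb)
  have h2 : (b : B) ≠ τ := fun hb => b.2 (Or.inr hb)
  rw [changeEquiv_apply, Finsupp.single_eq_of_ne' h1, Finsupp.single_eq_of_ne' h2, zero_smul,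
    zero_smul, add_zero, add_zero]
  congr 1
  classical
  ext1 b'
  change Finsupp.single (b : B) (1 : MvPolynomial X K) b' = _
  rw [Finsupp.single_apply, Finsupp.single_apply]
  exact if_congr Subtype.ext_iff.symm rfl rfl

theorem changeEquiv_single (h : C.IsCancellable σ τ c) (b : B) :
    h.changeEquiv (Finsupp.single b 1) = C.standardChange σ τ b := by
  have hinv : Ring.inverse (C.entry τ σ) = MvPolynomial.C c⁻¹ := by
    have hu : IsUnit (C.entry τ σ) := by
      rw [h.entry_eq]
      exact IsUnit.of_mul_eq_one_right _ h.C_inv_mul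
    refine hu.mul_right_cancel ?_
    rw [Ring.inverse_mul_cancel _ hu, h.entry_eq, h.C_inv_mul]
  rw [standardChange]
  by_cases hτ : b = τ
  · subst hτ
    rw [if_pos rfl, changeEquiv_apply]
    have : Finsupp.lsubtypeDomain (R := MvPolynomial X K) ({σ, b}ᶜ : Set B)
        (Finsupp.single b (1 : MvPolynomial X K)) = 0 := by
      ext1 b'
      exact Finsupp.single_eq_of_ne fun hb => b'.2 (Or.inr hb)
    rw [this, Finsupp.single_eq_of_ne h.ne]
    simp
  rw [if_neg hτ]
  by_cases hσ : b = σ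
  · subst hσ
    rw [if_neg (by simp), changeEquiv_apply]
    have : Finsupp.lsubtypeDomain (R := MvPolynomial X K) ({b, τ}ᶜ : Set B)
        (Finsupp.single b (1 : MvPolynomial X K)) = 0 := by
      ext1 b'
      exact Finsupp.single_eq_of_ne fun hb => b'.2 (Or.inl hb)
    rw [this, Finsupp.single_eq_of_ne h.ne.symm]
    simp
  have hb : b ∈ ({σ, τ}ᶜ : Set B) := by simp [hσ, hτ]
  rw [h.changeEquiv_single_val ⟨b, hb⟩, cancelInclusion_apply, Finsupp.mapDomain_single,
    cancelHomotopy_apply, hinv]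
  split_ifs with hdeg
  · rw [mul_comm]
    rfl
  -- The inclusion corrects every surviving basis element, while the standard change only touches
  -- the degree of `[σ]`; elsewhere the correction is zero for degree reasons.
  · have : C.d (Finsupp.single b 1) τ = 0 := by
      by_contra hne
      cases hj : C.hdeg b with
      | zero => simp [h.isComplex.d_zero b hj] at hne
      | succ j =>
        have := (h.isComplex.d_homogeneous b j hj τ hne).1
        exact hdeg ⟨by rw [hj, h.hdeg_eq, this], hσ⟩
    simp [this]

theorem isStandardCancellation (h : C.IsCancellable σ τ c) :
    C.IsStandardCancellation σ τ (C.cancel σ τ c) Subtype.val := by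
  refine ⟨h.hdeg_eq, ?_, Subtype.val_injective, Subtype.range_coe, fun _ => rfl, fun _ => rfl,
    Module.Basis.ofRepr h.changeEquiv.symm, fun b => ?_, fun b b' => ?_⟩
  · rw [h.entry_eq]
    exact IsUnit.of_mul_eq_one_right _ h.C_inv_mul
  · rw [Module.Basis.coe_ofRepr]
    exact h.changeEquiv_single b
  · rw [Module.Basis.coe_ofRepr]
    change _ = h.changeEquiv.symm (C.d (h.changeEquiv (Finsupp.single (b : B) 1))) b'
    rw [h.changeEquiv_symm_apply, h.changeEquiv_single_val]
    rfl

end IsCancellable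

end Cancellation

end BasedComplex

/-! ### All the cancellations -/

section AllCancellations

open BasedComplex

variable {K X : Type*} [Field K] {r : ℕ} {l : Fin r → X →₀ ℕ} {k : Fin r}
  {M : Ideal (MvPolynomial X K)}

theorem monomial_mem_span_X {u : X →₀ ℕ} (hu : u ≠ 0) (c : K) :
    monomial u c ∈ Ideal.span (Set.range (MvPolynomial.X : X → MvPolynomial X K)) := by
  obtain ⟨i, hi⟩ := Finsupp.ne_iff.1 hu
  have h : Finsupp.single i 1 ≤ u := by
    rw [Finsupp.single_le_iff]
    exact Nat.one_le_iff_ne_zero.2 hi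
  have := Ideal.mul_mem_left (Ideal.span (Set.range (MvPolynomial.X : X → MvPolynomial X K)))
    (monomial (u - Finsupp.single i 1) c) (Ideal.subset_span ⟨i, rfl⟩)
  rwa [MvPolynomial.X, monomial_mul, tsub_add_cancel_of_le h, mul_one] at this

namespace BasedComplex

/-- A nonzero entry joins basis elements of different homological degrees, which then have different
multidegrees, so its monomial is divisible by a variable. -/
theorem isMinimalFreeResolution_of_mdeg_injective {B : Type*} {F : BasedComplex K X B}
    (hF : F.IsFreeResolution M) (hinj : Function.Injective F.mdeg) :
    F.IsMinimalFreeResolution M := by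
  refine ⟨hF, ?_⟩
  rintro _ ⟨x, rfl⟩
  rw [apply_eq_sum]
  refine Submodule.sum_mem _ fun b _ => Submodule.smul_mem _ _ ?_
  cases hb : F.hdeg b with
  | zero =>
    rw [hF.1.d_zero b hb]
    exact Submodule.zero_mem _
  | succ j =>
    have hd := hF.1.d_homogeneous b j hb
    rw [← Finsupp.sum_single (F.d (Finsupp.single b 1))]
    refine Submodule.sum_mem _ fun t ht => ?_
    obtain ⟨h1, h2, c, hc⟩ := hd t (by simpa using ht)
    have hne : F.mdeg b - F.mdeg t ≠ 0 := by
      intro h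
      have : b = t := hinj (le_antisymm (tsub_eq_zero_iff_le.1 h) h2)
      subst this
      omega
    have := Submodule.smul_mem_smul (monomial_mem_span_X hne c)
      (Submodule.mem_top (x := (Finsupp.single t 1 : B →₀ MvPolynomial X K)))
    rwa [Finsupp.smul_single, smul_eq_mul, mul_one, ← hc] at this

end BasedComplex

/-- After the cancellations of a list of pairs, the remaining pairs can still be cancelled. -/
theorem exists_cancelsTo_taylor (hM : IsMonomialIdeal M) (hl : Function.Injective l)
    (hlM : Set.range l = minimalGenerators M)
    (hdom : ∀ i, i ≠ k → IsDominantMonomial (Set.range l) (l i))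
    (L : List (Finset (Fin r) × Finset (Fin r))) (hnd : L.Nodup)
    (hL : ∀ p ∈ L, p ∈ cancellationPairs l k) :
    ∃ (N : Type) (F : BasedComplex K X N) (f : N → Finset (Fin r)),
      (taylor K l).CancelsTo L F f ∧ F.IsFreeResolution M ∧ Function.Injective f ∧
      (∀ s, s ∈ Set.range f ↔ ∀ p ∈ L, s ≠ p.1 ∧ s ≠ p.2) ∧
      (∀ b, F.mdeg b = (f b).sup l) ∧
      ∀ s t, (f s, f t) ∈ cancellationPairs l k →
        ∃ c : K, c ≠ 0 ∧ F.entry t s = MvPolynomial.C c := by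
  -- Induction from the end of the list, matching `CancelsTo`, which appends the latest
  -- cancellation.
  induction L using List.reverseRecOn with
  | nil =>
    refine ⟨_, taylor K l, id, CancelsTo.refl, ?_, Function.injective_id, by simp, fun _ => rfl,
      fun s t hst => exists_taylor_d_eq_C (p := (s, t)) hst⟩
    rw [isFreeResolution_iff, eq_span_range_of_range_eq_minimalGenerators hM hlM]
    exact ⟨_, taylor_isResolutionWith⟩
  | append_singleton L p ih =>
    have hnd' := List.nodup_append.1 hnd
    obtain ⟨N, F, f, hLF, hF, hf, hran, hmdeg, hent⟩ := ih hnd'.1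
      fun p hp => hL p (List.mem_append_left _ hp)
    have hpA : p ∈ cancellationPairs l k := hL p (by simp)
    have hpL : p ∉ L := fun h => hnd'.2.2 p h p (by simp) rfl
    have pair_eq : ∀ q ∈ cancellationPairs l k, q.1.sup l = p.1.sup l → q = p := by
      intro q hq h
      have he := erase_eq_erase_of_sup_eq hl hdom h
      rw [hq.2.2, hpA.2.2, Finset.erase_insert hq.1, Finset.erase_insert hpA.1] at he
      exact Prod.ext (by rw [hq.2.2, hpA.2.2, he]) he
    -- An element with the multidegree of `p` could only have been removed by `p` itself, which has
    -- not been used yet.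
    have hrem : ∀ s, s.sup l = p.1.sup l → s ∈ Set.range f := by
      intro s hs
      rw [hran]
      refine fun q hq => ⟨?_, ?_⟩ <;> rintro rfl <;> refine hpL (?_ : p ∈ L)
      · exact pair_eq q (hL q (List.mem_append_left _ hq)) hs ▸ hq
      · have hqA := hL q (List.mem_append_left _ hq)
        exact pair_eq q hqA ((sup_eq_of_mem_cancellationPairs hqA).trans hs) ▸ hq
    obtain ⟨σ, hσ⟩ := hrem p.1 rfl
    obtain ⟨τ, hτ⟩ := hrem p.2 (sup_eq_of_mem_cancellationPairs hpA).symm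
    have hp : p = (f σ, f τ) := by rw [hσ, hτ]
    obtain ⟨c, hc, hcF⟩ := hent σ τ (hp ▸ hpA)
    obtain ⟨ε, hε⟩ := isFreeResolution_iff.1 hF
    have hcan : F.IsCancellable σ τ c := ⟨hε.isComplex, hc, hcF⟩
    refine ⟨_, F.cancel σ τ c, f ∘ Subtype.val, ?_,
      isFreeResolution_iff.2 ⟨_, hcan.isResolutionWith_cancel hε⟩,
      hf.comp Subtype.val_injective, ?_, fun b => hmdeg b, ?_⟩
    · rw [hp]
      exact hLF.step hcan.isStandardCancellation
    · intro s
      have happ : (∀ q ∈ L ++ [p], s ≠ q.1 ∧ s ≠ q.2) ↔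
          (∀ q ∈ L, s ≠ q.1 ∧ s ≠ q.2) ∧ s ≠ p.1 ∧ s ≠ p.2 := by
        rw [List.forall_mem_append, List.forall_mem_singleton]
      rw [happ, ← hran, ← hσ, ← hτ]
      constructor
      · rintro ⟨b, rfl⟩
        exact ⟨⟨b, rfl⟩, fun h => b.2 (Or.inl (hf h)), fun h => b.2 (Or.inr (hf h))⟩
      · rintro ⟨⟨b, rfl⟩, h1, h2⟩
        exact ⟨⟨b, by rintro (rfl | rfl) <;> contradiction⟩, rfl⟩
    · intro s t hst
      obtain ⟨e, he, heF⟩ := hent s t hst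
      refine ⟨e, he, ?_⟩
      rw [hcan.cancel_entry, heF, sub_eq_self]
      -- A nonzero correction gives `mdeg τ ≤ mdeg s` and `mdeg t ≤ mdeg σ`. Multidegrees agree
      -- within each pair, so all four coincide and `(f s, f t)` would be the pair just removed.
      by_contra hne
      have h1 : F.entry τ s ≠ 0 := fun h => hne (by rw [h]; simp)
      have h2 : F.entry t σ ≠ 0 := fun h => hne (by rw [h]; simp)
      have hle : ∀ {a b : N}, F.entry a b ≠ 0 → F.mdeg a ≤ F.mdeg b := by
        intro a b hab
        cases hb : F.hdeg b with
        | zero => exact absurd (by rw [entry, hε.isComplex.d_zero b hb]; rfl) hab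
        | succ j => exact (hε.isComplex.d_homogeneous b j hb a hab).2.1
      have hst' : F.mdeg s = F.mdeg t := by
        rw [hmdeg, hmdeg]
        exact sup_eq_of_mem_cancellationPairs hst
      have h3 : F.mdeg s = F.mdeg σ :=
        le_antisymm (hst'.trans_le (hle h2)) (hcan.mdeg_eq.trans_le (hle h1))
      rw [hmdeg, hmdeg, hσ] at h3
      have h4 := congrArg Prod.fst (pair_eq _ hst h3)
      exact s.2 (Or.inl (hf (h4.trans hσ.symm)))

/-- Once all pairs are cancelled, the multidegrees are pairwise distinct, so that the result is
minimal. -/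
theorem exists_cancelsTo_taylor_minimal (hM : IsMonomialIdeal M) (hl : Function.Injective l)
    (hlM : Set.range l = minimalGenerators M)
    (hdom : ∀ i, i ≠ k → IsDominantMonomial (Set.range l) (l i))
    (L : List (Finset (Fin r) × Finset (Fin r))) (hnd : L.Nodup)
    (hL : ∀ p, p ∈ L ↔ p ∈ cancellationPairs l k) :
    ∃ (N : Type) (F : BasedComplex K X N) (f : N → Finset (Fin r)),
      (taylor K l).CancelsTo L F f ∧ F.IsMinimalFreeResolution M := by
  obtain ⟨N, F, f, hLF, hF, hf, hran, hmdeg, -⟩ :=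
    exists_cancelsTo_taylor hM hl hlM hdom L hnd fun p hp => (hL p).1 hp
  refine ⟨N, F, f, hLF, isMinimalFreeResolution_of_mdeg_injective hF fun b b' hbb' => ?_⟩
  rw [hmdeg, hmdeg] at hbb'
  by_contra hne
  rcases mem_cancellationPairs_of_sup_eq hl hdom hbb' (hf.ne hne) with h | h
  · exact ((hran _).1 ⟨b, rfl⟩ _ ((hL _).2 h)).1 rfl
  · exact ((hran _).1 ⟨b', rfl⟩ _ ((hL _).2 h)).1 rfl

end AllCancellations

theorem theorem5p8 {K X : Type*} [Field K] [Finite X]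
    (M : Ideal (MvPolynomial X K)) (hM : IsSemidominantIdeal M)
    {r : ℕ} (l : Fin r → X →₀ ℕ) (hl : Function.Injective l)
    (hlM : Set.range l = minimalGenerators M)
    (k : Fin r) (hk : ¬ IsDominantMonomial (minimalGenerators M) (l k)) :
    -- all cancellations of `A`, in any order, can be made and lead to a minimal free resolution
    (∀ L : List (Finset (Fin r) × Finset (Fin r)), L.Nodup →
      (∀ p, p ∈ L ↔ p ∈ cancellationPairs l k) →
      ∃ (B : Type) (F : BasedComplex K X B) (f : B → Finset (Fin r)),
        (taylor K l).CancelsTo L F f ∧ F.IsMinimalFreeResolution M) ∧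
    -- the Taylor resolution is the minimal free resolution plus the trivial complexes
    (∀ (B : Type*) (F : BasedComplex K X B), F.IsMinimalFreeResolution M →
      (taylor K l).Iso (F.sum (BasedComplex.directSum fun p : cancellationPairs l k =>
        (taylor K l).trivialComplex p.1.1 p.1.2))) := by
  have hdom : ∀ i, i ≠ k → IsDominantMonomial (Set.range l) (l i) := by
    intro i hik
    by_contra hi
    rw [hlM] at hi
    exact hik (hl (hM.2.unique ⟨hlM ▸ ⟨i, rfl⟩, hi⟩ ⟨hlM ▸ ⟨k, rfl⟩, hk⟩))
  exact ⟨exists_cancelsTo_taylor_minimal hM.1 hl hlM hdom,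
    fun B F hF => taylor_iso_sum_trivialPart hM.1 hl hlM hdom hF⟩
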